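/- Work in a fixed countably saturated nonstandard universe, with set ${}^*\mathbb N$ of hyperintegers; countable saturation means that every sequence of internal sets with the finite intersection property has non-empty intersection. A set $X$ is *countably determined* (CD) if $$X=\bigcup_{b\in B}\Bigl(\bigcap_{m\in b}X_m\cap\bigcap_{m\notin b}\bigl(\textstyle\bigcup_n X_n\bigr)\setminus X_m\Bigr)$$ for some sequence of internal sets $X_m$ ($m\in\mathbb N$) and some $B\subseteq\mathcal P(\mathbb N)$; a map is CD if its graph is. For CD sets $X,Y$ write $X\le_{CD}Y$ if there is a CD injection $X\to Y$, $X\equiv_{CD}Y$ if $X\le_{CD}Y$ and $Y\le_{CD}X$, and $X<_{CD}Y$ if $X\le_{CD}Y$ but not $Y\le_{CD}X$. For an infinitely large $c\in{}^*\mathbb N$ put $$c\mathbb N=\{y\in{}^*\mathbb N: y<cn\text{ for some }n\in\mathbb N\},\qquad c/\mathbb N=\{y\in{}^*\mathbb N: yn<c\text{ for all }n\in\mathbb N\}.$$ For infinitely large $d\in{}^*\mathbb N$ and $G\subseteq\{0,1\}^{\mathbb N}$ let $M^d_G$ be the set of all internal functions $\xi:[0,d)\to\{0,1\}$ with $\xi{\restriction}\mathbb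 N\in G$. **Theorem.** Let $c=2^d\in{}^*\mathbb N\setminus\mathbb N$, where $d\in{}^*\mathbb N$, and let $X\subseteq c\mathbb N$ be a CD set. Then either $X<_{CD}c/\mathbb N$, or $X\equiv_{CD}M^d_G$ for some $G\subseteq\{0,1\}^{\mathbb N}$. -/

import Mathlib

universe u

/-- Names for the standard sets of finite type over the natural numbers:
`ℕ`, Cartesian products and power sets. -/
inductive StdType : Type
  | nat : StdType
  | prod : StdType → StdType → StdType
  | pow : StdType → StdType

/-- The standard set named by a type symbol. -/
@[reducible] def StdType.El : StdType → Type
  | .nat => ℕ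
  | .prod σ τ => StdType.El σ × StdType.El τ
  | .pow σ => Set (StdType.El σ)

/-- A countably saturated nonstandard universe over `ℕ`.

Every standard set `A` of finite type over `ℕ` has an extension `*A`, every standard map
`f : A → B` has an extension `*f : *A → *B`, every `S ⊆ A` has an extension `*S ⊆ *A`, and every
`a ∈ A` has a copy `*a ∈ *A`. The transfer principle is given in its algebraic form: the star
operation preserves composition, Cartesian products (with their coordinate maps), complements and
intersections (propositional connectives), preimages (substitution of terms) and images
(existential quantification); hence all first-order statements about sets of finite type hold for
the standard objects if and only if they hold for their extensions.

The elements of `*(P A)` stand for the internal subsets of `*A` (see `ext` below), and the field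
`saturation` is countable saturation. -/
structure NonstandardUniverse where
  Star : StdType → Type u
  star : ∀ {σ : StdType}, σ.El → Star σ
  map : ∀ {σ τ : StdType}, (σ.El → τ.El) → Star σ → Star τ
  starSet : ∀ {σ : StdType}, Set σ.El → Set (Star σ)
  pair : ∀ {σ τ : StdType}, Star σ → Star τ → Star (.prod σ τ)
  map_id : ∀ {σ : StdType} (x : Star σ), map (fun a : σ.El => a) x = x
  map_comp : ∀ {σ τ ρ : StdType} (g : τ.El → ρ.El) (f : σ.El → τ.El) (x : Star σ),
    map (fun a => g (f a)) x = map g (map f x)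
  map_fst_pair : ∀ {σ τ : StdType} (x : Star σ) (y : Star τ),
    map (σ := .prod σ τ) (τ := σ) Prod.fst (pair x y) = x
  map_snd_pair : ∀ {σ τ : StdType} (x : Star σ) (y : Star τ),
    map (σ := .prod σ τ) (τ := τ) Prod.snd (pair x y) = y
  pair_eta : ∀ {σ τ : StdType} (z : Star (.prod σ τ)),
    pair (map (σ := .prod σ τ) (τ := σ) Prod.fst z)
      (map (σ := .prod σ τ) (τ := τ) Prod.snd z) = z
  starSet_singleton : ∀ {σ : StdType} (a : σ.El), starSet {a} = {star a}
  starSet_compl : ∀ {σ : StdType} (S : Set σ.El), starSet Sᶜ = (starSet S)ᶜ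
  starSet_inter : ∀ {σ : StdType} (S T : Set σ.El), starSet (S ∩ T) = starSet S ∩ starSet T
  starSet_preimage : ∀ {σ τ : StdType} (f : σ.El → τ.El) (T : Set τ.El),
    starSet (f ⁻¹' T) = map f ⁻¹' starSet T
  starSet_image : ∀ {σ τ : StdType} (f : σ.El → τ.El) (S : Set σ.El),
    starSet (f '' S) = map f '' starSet S
  saturation : ∀ {σ : StdType} (A : ℕ → Star (.pow σ)),
    (∀ n : ℕ, ∃ x : Star σ, ∀ m ≤ n,
      pair x (A m) ∈ starSet (σ := .prod σ (.pow σ)) {p | p.1 ∈ p.2}) →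
    ∃ x : Star σ, ∀ m : ℕ, pair x (A m) ∈ starSet (σ := .prod σ (.pow σ)) {p | p.1 ∈ p.2}

namespace NonstandardUniverse

/-- The set of all `x ∈ *A` that belong, in the sense of the extended membership relation, to the
element `S` of `*(P A)`. -/
def ext (U : NonstandardUniverse.{u}) {σ : StdType} (S : U.Star (.pow σ)) : Set (U.Star σ) :=
  {x | U.pair x S ∈ U.starSet (σ := .prod σ (.pow σ)) {p | p.1 ∈ p.2}}

/-- Internal subsets of `*A`. -/
def IsInternal (U : NonstandardUniverse.{u}) {σ : StdType} (X : Set (U.Star σ)) : Prop :=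
  ∃ S : U.Star (.pow σ), U.ext S = X

/-- Countably determined sets:
`X = ⋃_{b ∈ B} (⋂_{m ∈ b} X_m ∩ ⋂_{m ∉ b} (⋃_n X_n) ∖ X_m)` with all `X_m` internal and
`B ⊆ P(ℕ)` arbitrary. -/
def IsCD (U : NonstandardUniverse.{u}) {σ : StdType} (X : Set (U.Star σ)) : Prop :=
  ∃ (A : ℕ → Set (U.Star σ)) (B : Set (Set ℕ)), (∀ m, U.IsInternal (A m)) ∧
    X = ⋃ b ∈ B, ((⋂ m ∈ b, A m) ∩ ⋂ m ∈ bᶜ, ((⋃ n, A n) \ A m))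

/-- `X ≤_CD Y`: there is an injection `θ : X → Y` whose graph is countably determined. -/
def CDLe (U : NonstandardUniverse.{u}) {σ τ : StdType}
    (X : Set (U.Star σ)) (Y : Set (U.Star τ)) : Prop :=
  ∃ θ : U.Star σ → U.Star τ, Set.MapsTo θ X Y ∧ Set.InjOn θ X ∧
    U.IsCD ((fun x => U.pair x (θ x)) '' X)

/-- `X <_CD Y`. -/
def CDLt (U : NonstandardUniverse.{u}) {σ τ : StdType}
    (X : Set (U.Star σ)) (Y : Set (U.Star τ)) : Prop :=
  U.CDLe X Y ∧ ¬ U.CDLe Y X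

/-- `X ≡_CD Y`. -/
def CDEquiv (U : NonstandardUniverse.{u}) {σ τ : StdType}
    (X : Set (U.Star σ)) (Y : Set (U.Star τ)) : Prop :=
  U.CDLe X Y ∧ U.CDLe Y X

/-- The order of the hyperintegers `*ℕ`. -/
def hlt (U : NonstandardUniverse.{u}) (x y : U.Star .nat) : Prop :=
  U.pair x y ∈ U.starSet (σ := .prod .nat .nat) {p | p.1 < p.2}

/-- The product of two hyperintegers. -/
def hmul (U : NonstandardUniverse.{u}) (x y : U.Star .nat) : U.Star .nat :=
  U.map (σ := .prod .nat .nat) (τ := .nat) (fun p => p.1 * p.2) (U.pair x y)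

/-- The hyperinteger `2 ^ d`. -/
def htwoPow (U : NonstandardUniverse.{u}) (d : U.Star .nat) : U.Star .nat :=
  U.map (σ := .nat) (τ := .nat) (fun k => 2 ^ k) d

/-- The standard natural number `n` as a hyperinteger. -/
def hnat (U : NonstandardUniverse.{u}) (n : ℕ) : U.Star .nat :=
  U.star (σ := .nat) n

/-- `cℕ`, the set of all `y` with `y < c n` for some `n ∈ ℕ`. -/
def mulCut (U : NonstandardUniverse.{u}) (c : U.Star .nat) : Set (U.Star .nat) :=
  {y | ∃ n : ℕ, U.hlt y (U.hmul c (U.hnat n))}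

/-- `c/ℕ`, the set of all `y` with `y n < c` for all `n ∈ ℕ`. -/
def divCut (U : NonstandardUniverse.{u}) (c : U.Star .nat) : Set (U.Star .nat) :=
  {y | ∀ n : ℕ, U.hlt (U.hmul y (U.hnat n)) c}

/-- The set `2^d` of all internal functions `ξ : [0,d) → {0,1}`, as internal sets of pairs. -/
def internalSeqs (U : NonstandardUniverse.{u}) (d : U.Star .nat) :
    Set (U.Star (.pow (.prod .nat .nat))) :=
  {ξ | (∀ k i, U.pair k i ∈ U.ext ξ → U.hlt k d ∧ U.hlt i (U.hnat 2)) ∧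
    ∀ k, U.hlt k d → ∃! i, U.pair k i ∈ U.ext ξ}

/-- `M^d_G`, the set of all internal `ξ : [0,d) → {0,1}` whose restriction to `ℕ` is an element
of `G`. -/
def monadUnion (U : NonstandardUniverse.{u}) (d : U.Star .nat) (G : Set (ℕ → Fin 2)) :
    Set (U.Star (.pow (.prod .nat .nat))) :=
  {ξ | ξ ∈ U.internalSeqs d ∧
    ∃ g ∈ G, ∀ n : ℕ, U.pair (U.hnat n) (U.hnat (g n : ℕ)) ∈ U.ext ξ}

end NonstandardUniverse

/-! The monad of y < 2^d is the set of all numbers below 2^d with the same standard leading binary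
digits, so monads are named by points g of the Cantor space, and reading off digits turns M^d_G into
the union of the monads named by G. An internal Z is small if |Z| / 2^d is infinitesimal. Up to CD
equinumerosity, X turns out to be either part of a small set or a union of monads.

Reduction to [0, 2^d) (`exists_equiv_subset_lt_two_pow`): classes of binary sequences modulo finite
changes are countably infinite, so there is a bijection φ from 2^ℕ × ℕ to 2^ℕ with φ(g, n) equal to
g almost everywhere. The copy of the monad g in [nc, (n+1)c) is translated onto the monad φ(g, n),
and only countably many translations occur.

Sorting (`exists_sorted`): membership in X depends on the signature of a point, its sequence of
truth values for countably many internal sets. An internal permutation of [0, 2^d) makes signatures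
lexicographically increasing.

Dichotomy (`cdLe_or_of_monotone_signature`): fixing finitely many digits and truth values gives
countably many blocks, and saturation puts the small blocks into one small Z. Let G consist of those
g for which some admissible signature b has no small block along (g, b). Points of X outside Z lie
in monads from G. If G is empty, X lies in Z. Otherwise one monad absorbs Z, so X embeds into the
union over G. Conversely, for g in G saturation gives an internal injection of the monad g into its
intersection with X. By monotonicity only countably many monads carry two signatures; every other
monad from G lies inside X and is left alone, so countably many internal maps make up a CD
injection.

A subset of a small set is strictly below c/ℕ: a CD injection is covered by countably many internal
partial injections (`exists_internal_of_cdGraph`), and with values in Z these cannot exhaust a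
segment [0, a) of c/ℕ with a > m|Z| for all standard m (`not_cdLe_divCut_of_isSmall`). -/

namespace NonstandardUniverse

variable (U : NonstandardUniverse.{u}) {σ τ ρ υ : StdType}

/-! ### Transfer -/

/-- The hyperelement `w` satisfies the extension of the standard predicate `P`. -/
def Holds (w : U.Star σ) (P : σ.El → Prop) : Prop :=
  w ∈ U.starSet {a | P a}

variable {U}

theorem starSet_empty : U.starSet (∅ : Set σ.El) = ∅ := by
  have h := U.starSet_inter (σ := σ) ∅ ∅ᶜ
  rw [U.starSet_compl, Set.inter_compl_self, Set.inter_compl_self] at h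
  exact h

theorem starSet_univ : U.starSet (Set.univ : Set σ.El) = Set.univ := by
  rw [← Set.compl_empty, U.starSet_compl, starSet_empty, Set.compl_empty]

theorem holds_and {w : U.Star σ} {P Q : σ.El → Prop} :
    U.Holds w (fun a => P a ∧ Q a) ↔ U.Holds w P ∧ U.Holds w Q := by
  have := U.starSet_inter {a | P a} {a | Q a}
  exact Set.ext_iff.1 this w

theorem holds_not {w : U.Star σ} {P : σ.El → Prop} :
    U.Holds w (fun a => ¬ P a) ↔ ¬ U.Holds w P := by
  have := U.starSet_compl {a | P a}
  exact Set.ext_iff.1 this w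

theorem holds_of_forall {w : U.Star σ} {P : σ.El → Prop} (h : ∀ a, P a) : U.Holds w P := by
  have : {a | P a} = Set.univ := Set.eq_univ_of_forall h
  simp [Holds, this, starSet_univ]

theorem Holds.mono {w : U.Star σ} {P Q : σ.El → Prop} (hP : U.Holds w P) (h : ∀ a, P a → Q a) :
    U.Holds w Q := by
  have h1 : U.Holds w (fun a => P a ∧ Q a) := by
    have : {a | P a ∧ Q a} = {a | P a} := by ext a; exact ⟨fun h => h.1, fun h' => ⟨h', h a h'⟩⟩
    simpa [Holds, this] using hP
  exact (holds_and.1 h1).2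

theorem Holds.mono₂ {w : U.Star σ} {P Q R : σ.El → Prop} (hP : U.Holds w P) (hQ : U.Holds w Q)
    (h : ∀ a, P a → Q a → R a) : U.Holds w R :=
  (holds_and.2 ⟨hP, hQ⟩).mono fun a ha => h a ha.1 ha.2

theorem Holds.mono₃ {w : U.Star σ} {P Q R S : σ.El → Prop} (hP : U.Holds w P) (hQ : U.Holds w Q)
    (hR : U.Holds w R) (h : ∀ a, P a → Q a → R a → S a) : U.Holds w S :=
  (holds_and.2 ⟨hP, hQ⟩).mono₂ hR fun a ha => h a ha.1 ha.2

theorem holds_congr {w : U.Star σ} {P Q : σ.El → Prop} (h : ∀ a, P a ↔ Q a) :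
    U.Holds w P ↔ U.Holds w Q :=
  ⟨fun hp => hp.mono fun a => (h a).1, fun hp => hp.mono fun a => (h a).2⟩

theorem holds_imp {w : U.Star σ} {P Q : σ.El → Prop} :
    U.Holds w (fun a => P a → Q a) ↔ (U.Holds w P → U.Holds w Q) := by
  constructor
  · intro h hp
    exact h.mono₂ hp fun a h h' => h h'
  · intro h
    by_cases hp : U.Holds w P
    · exact (h hp).mono fun a ha _ => ha
    · exact (holds_not.2 hp).mono fun a ha h => absurd h ha

theorem holds_or {w : U.Star σ} {P Q : σ.El → Prop} :
    U.Holds w (fun a => P a ∨ Q a) ↔ U.Holds w P ∨ U.Holds w Q := by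
  rw [or_iff_not_imp_left, ← holds_not, ← holds_imp]
  exact holds_congr fun a => or_iff_not_imp_left

theorem holds_iff {w : U.Star σ} {P Q : σ.El → Prop} :
    U.Holds w (fun a => P a ↔ Q a) ↔ (U.Holds w P ↔ U.Holds w Q) := by
  rw [iff_iff_implies_and_implies (a := U.Holds w P), ← holds_imp, ← holds_imp, ← holds_and]
  exact holds_congr fun a => iff_iff_implies_and_implies

theorem holds_const {w : U.Star σ} {p : Prop} : U.Holds w (fun _ => p) ↔ p := by
  by_cases hp : p
  · exact ⟨fun _ => hp, fun _ => holds_of_forall fun _ => hp⟩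
  · exact ⟨fun h => absurd (holds_of_forall fun _ => hp) (holds_not.not_left.2 h), fun h => absurd h hp⟩

theorem holds_forall_lt {w : U.Star σ} {P : ℕ → σ.El → Prop} {k : ℕ} :
    U.Holds w (fun a => ∀ i < k, P i a) ↔ ∀ i < k, U.Holds w (P i) := by
  refine ⟨fun h i hi => h.mono fun a ha => ha i hi, ?_⟩
  induction k with
  | zero => exact fun _ => holds_of_forall fun a i hi => absurd hi (Nat.not_lt_zero i)
  | succ k ih =>
    intro h
    refine (ih fun i hi => h i (by omega)).mono₂ (h k (by omega)) fun a h1 h2 i hi => ?_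
    rcases Nat.lt_succ_iff_lt_or_eq.1 hi with h | rfl
    exacts [h1 i h, h2]

theorem holds_forall_le {w : U.Star σ} {P : ℕ → σ.El → Prop} {k : ℕ} :
    U.Holds w (fun a => ∀ i ≤ k, P i a) ↔ ∀ i ≤ k, U.Holds w (P i) := by
  simpa only [Nat.lt_succ_iff] using holds_forall_lt (w := w) (P := P) (k := k + 1)

theorem holds_map {w : U.Star σ} {f : σ.El → τ.El} {P : τ.El → Prop} :
    U.Holds (U.map f w) P ↔ U.Holds w (fun a => P (f a)) :=
  (Set.ext_iff.1 (U.starSet_preimage f {b | P b}) w).symm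

theorem map_fst (x : U.Star σ) (y : U.Star τ) :
    U.map (σ := .prod σ τ) (τ := σ) (fun p => p.1) (U.pair x y) = x := U.map_fst_pair x y

theorem map_snd (x : U.Star σ) (y : U.Star τ) :
    U.map (σ := .prod σ τ) (τ := τ) (fun p => p.2) (U.pair x y) = y := U.map_snd_pair x y

theorem map_map (g : τ.El → ρ.El) (f : σ.El → τ.El) (w : U.Star σ) :
    U.map g (U.map f w) = U.map (fun a => g (f a)) w := (U.map_comp g f w).symm

theorem pair_map (f : σ.El → τ.El) (g : σ.El → ρ.El) (w : U.Star σ) :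
    U.pair (U.map f w) (U.map g w) = U.map (τ := .prod τ ρ) (fun a => (f a, g a)) w := by
  rw [← U.pair_eta (U.map (τ := .prod τ ρ) (fun a => (f a, g a)) w), ← U.map_comp, ← U.map_comp]

theorem pair_inj {x x' : U.Star σ} {y y' : U.Star τ} (h : U.pair x y = U.pair x' y') :
    x = x' ∧ y = y' := by
  constructor
  · rw [← map_fst x y, h, map_fst]
  · rw [← map_snd x y, h, map_snd]

theorem map_const (a : τ.El) (w : U.Star σ) : U.map (fun _ => a) w = U.star a := by
  have : U.Holds (U.map (fun _ : σ.El => a) w) (fun b => b = a) :=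
    holds_map.2 (holds_of_forall fun _ => rfl)
  have h2 : U.map (fun _ : σ.El => a) w ∈ U.starSet {a} := this
  rwa [U.starSet_singleton] at h2

/-- The diagonal is the image of a ↦ (a, a), so preservation of images makes its extension the true
diagonal; this is what lets equality transfer. -/
theorem holds_eq {w : U.Star σ} {f g : σ.El → τ.El} :
    U.Holds w (fun a => f a = g a) ↔ U.map f w = U.map g w := by
  have hd := U.starSet_image (σ := τ) (τ := .prod τ τ) (fun a => (a, a)) Set.univ
  have h1 : U.Holds w (fun a => f a = g a) ↔
      U.pair (U.map f w) (U.map g w) ∈ U.starSet (σ := .prod τ τ)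
        ((fun a : τ.El => (a, a)) '' Set.univ) := by
    rw [pair_map]
    change _ ↔ U.Holds (σ := .prod τ τ) _
      (fun p => p ∈ ((fun a : τ.El => (a, a)) '' (Set.univ : Set τ.El)))
    rw [holds_map]
    refine holds_congr fun a => ?_
    constructor
    · intro h; exact ⟨f a, trivial, by rw [h]⟩
    · rintro ⟨b, -, hb⟩
      exact (congrArg Prod.fst hb).symm.trans (congrArg Prod.snd hb)
  rw [h1, hd, starSet_univ]
  constructor
  · rintro ⟨v, -, hv⟩
    rw [← pair_map (fun a => a) (fun a => a), U.map_id] at hv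
    exact (pair_inj hv).1.symm.trans (pair_inj hv).2
  · intro h
    refine ⟨U.map f w, trivial, ?_⟩
    rw [← pair_map (fun a => a) (fun a => a), U.map_id, ← h]

/-- A standard Skolem function for P, extended and applied to w, provides the witness. If the type
of witnesses is empty, the existential fails everywhere. -/
theorem holds_exists {w : U.Star σ} {P : σ.El → τ.El → Prop} :
    U.Holds w (fun a => ∃ b, P a b) ↔
      ∃ y, U.Holds (σ := .prod σ τ) (U.pair w y) (fun p => P p.1 p.2) := by
  constructor
  · intro h
    classical
    by_cases hne : Nonempty τ.El
    · let f : σ.El → τ.El := fun a => if h : ∃ b, P a b then h.choose else Classical.arbitrary _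
      refine ⟨U.map f w, ?_⟩
      rw [show U.pair w (U.map f w) = U.map (τ := .prod σ τ) (fun a => (a, f a)) w by
        rw [← pair_map, U.map_id], holds_map]
      refine h.mono fun a ha => ?_
      simp only [f, dif_pos ha]
      exact ha.choose_spec
    · exact absurd (holds_of_forall fun a ⟨b, _⟩ => hne ⟨b⟩) (holds_not.not_left.2 h)
  · rintro ⟨y, hy⟩
    have : U.Holds (σ := .prod σ τ) (U.pair w y) (fun p => ∃ b, P p.1 b) := hy.mono fun p hp => ⟨_, hp⟩
    have := (holds_map (U := U) (σ := .prod σ τ) (τ := σ) (f := fun p => p.1)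
      (P := fun a => ∃ b, P a b) (w := U.pair w y)).2 this
    rwa [map_fst] at this

theorem holds_forall {w : U.Star σ} {P : σ.El → τ.El → Prop} :
    U.Holds w (fun a => ∀ b, P a b) ↔
      ∀ y, U.Holds (σ := .prod σ τ) (U.pair w y) (fun p => P p.1 p.2) := by
  rw [← not_iff_not, ← holds_not, not_forall]
  simp only [← holds_not]
  rw [← holds_exists (U := U) (P := fun a b => ¬ P a b)]
  exact holds_congr fun a => not_forall

/-- Predicates of the parameter alone. -/
theorem holds_pair_fst {z : U.Star ρ} {x : U.Star σ} {P : ρ.El → Prop} :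
    U.Holds (σ := .prod ρ σ) (U.pair z x) (fun p => P p.1) ↔ U.Holds z P := by
  rw [← holds_map (U := U) (σ := .prod ρ σ) (f := fun p => p.1), map_fst]

theorem holds_pair_snd {z : U.Star ρ} {x : U.Star σ} {P : σ.El → Prop} :
    U.Holds (σ := .prod ρ σ) (U.pair z x) (fun p => P p.2) ↔ U.Holds x P := by
  rw [← holds_map (U := U) (σ := .prod ρ σ) (f := fun p => p.2), map_snd]

theorem eq_of_holds_pair {x y : U.Star σ} :
    U.Holds (σ := .prod σ σ) (U.pair x y) (fun p => p.1 = p.2) ↔ x = y := by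
  rw [holds_eq (U := U) (σ := .prod σ σ), map_fst, map_snd]

/-! ### Internal sets and functions -/

/-- The internal function `x ↦ *f(z, x)` with parameter `z`. -/
def app (f : ρ.El → σ.El → τ.El) (z : U.Star ρ) (x : U.Star σ) : U.Star τ :=
  U.map (σ := .prod ρ σ) (fun p => f p.1 p.2) (U.pair z x)

/-- The internal relation `*P(z, x)`. -/
def Rel (P : ρ.El → σ.El → Prop) (z : U.Star ρ) (x : U.Star σ) : Prop :=
  U.Holds (σ := .prod ρ σ) (U.pair z x) (fun p => P p.1 p.2)

theorem mem_ext_map {w : U.Star ρ} {x : U.Star σ} {t : ρ.El → Set σ.El} :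
    x ∈ U.ext (U.map (τ := .pow σ) t w) ↔ U.Rel (fun a b => b ∈ t a) w x := by
  have : U.pair x (U.map (τ := .pow σ) t w) = U.map (σ := .prod ρ σ) (τ := .prod σ (.pow σ))
      (fun p => (p.2, t p.1)) (U.pair w x) := by
    rw [← pair_map (σ := .prod ρ σ) (τ := σ) (ρ := .pow σ) (fun p => p.2) (fun p => t p.1),
      map_snd, ← map_map (σ := .prod ρ σ) (τ := ρ) (ρ := .pow σ) t (fun p => p.1), map_fst]
  change U.Holds (σ := .prod σ (.pow σ)) _ (fun p => p.1 ∈ p.2) ↔ _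
  rw [this, holds_map]
  rfl

theorem mem_ext_iff {A : U.Star (.pow σ)} {x : U.Star σ} :
    x ∈ U.ext A ↔ U.Rel (ρ := .pow σ) (fun A b => b ∈ A) A x := by
  rw [← mem_ext_map (ρ := .pow σ) (t := fun A => A), U.map_id]

theorem isInternal_rel (P : ρ.El → σ.El → Prop) (z : U.Star ρ) : U.IsInternal {x | U.Rel P z x} :=
  ⟨U.map (τ := .pow σ) (fun a => {b | P a b}) z, by ext x; exact mem_ext_map⟩

theorem isInternal_iff {X : Set (U.Star σ)} :
    U.IsInternal X ↔ ∃ A : U.Star (.pow σ), X = {x | U.Rel (ρ := .pow σ) (fun A b => b ∈ A) A x} := by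
  constructor
  · rintro ⟨A, rfl⟩
    exact ⟨A, Set.ext fun x => mem_ext_iff⟩
  · rintro ⟨A, rfl⟩
    exact isInternal_rel _ _

theorem isInternal_holds (P : σ.El → Prop) : U.IsInternal {x | U.Holds x P} := by
  convert isInternal_rel (U := U) (ρ := .nat) (fun _ b => P b) (U.star 0) using 1
  ext x
  exact holds_pair_snd.symm

theorem IsInternal.compl {X : Set (U.Star σ)} (h : U.IsInternal X) : U.IsInternal Xᶜ := by
  obtain ⟨A, rfl⟩ := isInternal_iff.1 h
  convert isInternal_rel (U := U) (ρ := .pow σ) (fun A b => ¬ b ∈ A) A using 1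
  ext x
  exact holds_not.symm

/-- Rewriting a relation with one parameter as a relation with a larger one. -/
theorem rel_comp {P : ρ.El → σ.El → Prop} (f : τ.El → ρ.El) (g : τ.El → υ.El → σ.El)
    {z : U.Star τ} {x : U.Star υ} :
    U.Rel P (U.map f z) (app g z x) ↔ U.Rel (fun a b => P (f a) (g a b)) z x := by
  unfold Rel app
  rw [← map_fst z x, map_map (σ := .prod τ υ) (τ := τ), map_fst, pair_map (σ := .prod τ υ), holds_map]

theorem app_pair_snd {z : U.Star ρ} {x : U.Star σ} : app (fun _ b => b) z x = x := map_snd z x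

theorem IsInternal.inter {X Y : Set (U.Star σ)} (h : U.IsInternal X) (h' : U.IsInternal Y) :
    U.IsInternal (X ∩ Y) := by
  obtain ⟨A, rfl⟩ := isInternal_iff.1 h
  obtain ⟨B, rfl⟩ := isInternal_iff.1 h'
  convert isInternal_rel (U := U) (ρ := .prod (.pow σ) (.pow σ)) (fun A b => b ∈ A.1 ∧ b ∈ A.2)
    (U.pair A B) using 1
  ext x
  unfold Rel
  rw [Set.mem_ofPred, holds_and]
  have h1 := rel_comp (U := U) (P := fun (A : (StdType.pow σ).El) b => b ∈ A)
    (τ := .prod (.pow σ) (.pow σ)) (fun p => p.1) (fun _ b => b) (z := U.pair A B) (x := x)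
  have h2 := rel_comp (U := U) (P := fun (A : (StdType.pow σ).El) b => b ∈ A)
    (τ := .prod (.pow σ) (.pow σ)) (fun p => p.2) (fun _ b => b) (z := U.pair A B) (x := x)
  rw [map_fst, app_pair_snd] at h1
  rw [map_snd, app_pair_snd] at h2
  exact and_congr h1 h2

/-- Internal functions. -/
def InternalFun (F : U.Star σ → U.Star τ) : Prop :=
  ∃ (ρ : StdType) (z : U.Star ρ) (f : ρ.El → σ.El → τ.El), F = app f z

theorem internalFun_app (f : ρ.El → σ.El → τ.El) (z : U.Star ρ) : InternalFun (app f z) :=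
  ⟨ρ, z, f, rfl⟩

theorem internalFun_map (f : σ.El → τ.El) : InternalFun (U := U) (U.map f) := by
  refine ⟨.nat, U.star 0, fun _ b => f b, ?_⟩
  ext x
  unfold app
  rw [← map_map (σ := .prod .nat σ) (τ := σ) f (fun p => p.2), map_snd]

theorem internalFun_id : InternalFun (U := U) (fun x : U.Star σ => x) := by
  convert internalFun_map (U := U) (fun a : σ.El => a) using 1
  ext x
  rw [U.map_id]

theorem pair_fst_param (z : U.Star ρ) (z' : U.Star τ) (x : U.Star σ) :
    U.map (σ := .prod (.prod ρ τ) σ) (τ := .prod ρ σ) (fun p => (p.1.1, p.2))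
      (U.pair (U.pair z z') x) = U.pair z x := by
  rw [← pair_map (σ := .prod (.prod ρ τ) σ) (τ := ρ) (ρ := σ) (fun p => p.1.1) (fun p => p.2),
    map_snd, ← map_map (σ := .prod (.prod ρ τ) σ) (τ := .prod ρ τ) (ρ := ρ) (fun p => p.1)
      (fun p => p.1), map_fst, map_fst]

theorem pair_snd_param (z : U.Star ρ) (z' : U.Star τ) (x : U.Star σ) :
    U.map (σ := .prod (.prod ρ τ) σ) (τ := .prod τ σ) (fun p => (p.1.2, p.2))
      (U.pair (U.pair z z') x) = U.pair z' x := by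
  rw [← pair_map (σ := .prod (.prod ρ τ) σ) (τ := τ) (ρ := σ) (fun p => p.1.2) (fun p => p.2),
    map_snd, ← map_map (σ := .prod (.prod ρ τ) σ) (τ := .prod ρ τ) (ρ := τ) (fun p => p.2)
      (fun p => p.1), map_fst, map_snd]

theorem rel_fst_param {P : ρ.El → σ.El → Prop} {z : U.Star ρ} {z' : U.Star τ} {x : U.Star σ} :
    U.Rel (ρ := .prod ρ τ) (fun p b => P p.1 b) (U.pair z z') x ↔ U.Rel P z x := by
  unfold Rel
  rw [← pair_fst_param z z' x, holds_map]

theorem rel_snd_param {P : τ.El → σ.El → Prop} {z : U.Star ρ} {z' : U.Star τ} {x : U.Star σ} :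
    U.Rel (ρ := .prod ρ τ) (fun p b => P p.2 b) (U.pair z z') x ↔ U.Rel P z' x := by
  unfold Rel
  rw [← pair_snd_param z z' x, holds_map]

theorem app_fst_param (f : ρ.El → σ.El → υ.El) (z : U.Star ρ) (z' : U.Star τ) (x : U.Star σ) :
    app (ρ := .prod ρ τ) (fun p b => f p.1 b) (U.pair z z') x = app f z x := by
  unfold app
  rw [← pair_fst_param z z' x, map_map (σ := .prod (.prod ρ τ) σ) (τ := .prod ρ σ)]

theorem app_snd_param (f : τ.El → σ.El → υ.El) (z : U.Star ρ) (z' : U.Star τ) (x : U.Star σ) :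
    app (ρ := .prod ρ τ) (fun p b => f p.2 b) (U.pair z z') x = app f z' x := by
  unfold app
  rw [← pair_snd_param z z' x, map_map (σ := .prod (.prod ρ τ) σ) (τ := .prod τ σ)]

/-- Substitution of an internal function into an internal function. -/
theorem app_app (f : ρ.El → σ.El → τ.El) (f' : ρ.El → τ.El → υ.El) (z : U.Star ρ) (x : U.Star σ) :
    app f' z (app f z x) = app (fun a b => f' a (f a b)) z x := by
  have : U.pair z (app f z x) = U.map (σ := .prod ρ σ) (τ := .prod ρ τ)
      (fun p => (p.1, f p.1 p.2)) (U.pair z x) := by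
    rw [← pair_map (σ := .prod ρ σ), map_fst, app]
  rw [app, this, map_map (σ := .prod ρ σ), app]

/-- Substitution of an internal function into an internal relation. -/
theorem rel_app {P : ρ.El → τ.El → Prop} (f : ρ.El → σ.El → τ.El) {z : U.Star ρ} {x : U.Star σ} :
    U.Rel P z (app f z x) ↔ U.Rel (fun a b => P a (f a b)) z x := by
  have : U.pair z (app f z x) = U.map (σ := .prod ρ σ) (τ := .prod ρ τ)
      (fun p => (p.1, f p.1 p.2)) (U.pair z x) := by
    rw [← pair_map (σ := .prod ρ σ), map_fst, app]
  rw [Rel, this, holds_map, Rel]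

theorem app_eq_app {f g : ρ.El → σ.El → τ.El} {z : U.Star ρ} {x : U.Star σ} :
    app f z x = app g z x ↔ U.Rel (fun a b => f a b = g a b) z x :=
  (holds_eq (U := U) (σ := .prod ρ σ)).symm

theorem InternalFun.comp {F : U.Star σ → U.Star τ} {F' : U.Star τ → U.Star υ}
    (h' : InternalFun F') (h : InternalFun F) : InternalFun (fun x => F' (F x)) := by
  obtain ⟨ρ, z, f, rfl⟩ := h
  obtain ⟨ρ', z', f', rfl⟩ := h'
  refine ⟨.prod ρ ρ', U.pair z z', fun p b => f' p.2 (f p.1 b), ?_⟩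
  ext x
  rw [← app_app (ρ := .prod ρ ρ') (fun p b => f p.1 b) (fun p b => f' p.2 b), app_fst_param,
    app_snd_param]

theorem InternalFun.pair {F : U.Star σ → U.Star τ} {F' : U.Star σ → U.Star ρ}
    (h : InternalFun F) (h' : InternalFun F') : InternalFun (fun x => U.pair (F x) (F' x)) := by
  obtain ⟨υ, z, f, rfl⟩ := h
  obtain ⟨υ', z', f', rfl⟩ := h'
  refine ⟨.prod υ υ', U.pair z z', fun p b => (f p.1 b, f' p.2 b), ?_⟩
  ext x
  rw [← app_fst_param f z z', ← app_snd_param f' z z']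
  exact pair_map (σ := .prod (.prod υ υ') σ) (fun p => f p.1.1 p.2) (fun p => f' p.1.2 p.2) _

theorem internalFun_const (y : U.Star τ) : InternalFun (U := U) (fun _ : U.Star σ => y) :=
  ⟨τ, y, fun a _ => a, by ext x; exact (map_fst y x).symm⟩

theorem IsInternal.preimage {X : Set (U.Star τ)} (h : U.IsInternal X) {F : U.Star σ → U.Star τ}
    (hF : InternalFun F) : U.IsInternal (F ⁻¹' X) := by
  obtain ⟨A, rfl⟩ := isInternal_iff.1 h
  have hG : InternalFun (fun x => U.pair A (F x)) := by
    exact (internalFun_const A).pair hF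
  obtain ⟨ρ, z, f, hf⟩ := hG
  convert isInternal_rel (U := U) (fun a b => (f a b).2 ∈ (f a b).1) z using 1
  ext x
  have h1 : U.Rel (ρ := .pow τ) (fun A b => b ∈ A) A (F x) ↔ U.Rel (fun a b => (f a b).2 ∈ (f a b).1) z x := by
    unfold Rel
    rw [congrFun hf x, app, holds_map]
  exact h1

theorem InternalFun.isInternal_eq {F F' : U.Star σ → U.Star τ} (h : InternalFun F)
    (h' : InternalFun F') : U.IsInternal {x | F x = F' x} := by
  convert (isInternal_holds (U := U) (σ := .prod τ τ) (fun p => p.1 = p.2)).preimage (h.pair h')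
    using 1
  ext x
  exact eq_of_holds_pair.symm

/-- Countable saturation. -/
theorem exists_forall_mem {A : ℕ → Set (U.Star σ)} (hA : ∀ m, U.IsInternal (A m))
    (h : ∀ n, ∃ x, ∀ m ≤ n, x ∈ A m) : ∃ x, ∀ m, x ∈ A m := by
  choose S hS using hA
  simp only [← hS] at h ⊢
  exact U.saturation S h

/-! ### Countably determined sets and maps -/

theorem isInternal_univ : U.IsInternal (Set.univ : Set (U.Star σ)) := by
  convert isInternal_holds (U := U) (fun _ : σ.El => True) using 1
  exact (Set.eq_univ_of_forall fun x => holds_const.2 trivial).symm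

theorem isCD_of_isInternal_nat {A : ℕ → Set (U.Star σ)} (hA : ∀ i, U.IsInternal (A i))
    (Q : Set ℕ → Prop) : U.IsCD {x | Q {i | x ∈ A i}} := by
  -- The defining formula only sees points of the union of the sets, so the whole space is prepended
  -- to the sequence and index i becomes i + 1.
  obtain ⟨A', h0, hs⟩ : ∃ A' : ℕ → Set (U.Star σ), A' 0 = Set.univ ∧ ∀ n, A' (n + 1) = A n :=
    ⟨fun n => Nat.casesOn n Set.univ A, rfl, fun _ => rfl⟩
  refine ⟨A', {b | 0 ∈ b ∧ Q {i | i + 1 ∈ b}}, ?_, ?_⟩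
  · rintro (_ | m)
    exacts [h0 ▸ isInternal_univ, hs m ▸ hA m]
  · have hx0 : ∀ x, x ∈ A' 0 := fun x => h0 ▸ Set.mem_univ x
    simp only [← hs]
    ext x
    simp only [Set.mem_ofPred, Set.mem_iUnion, Set.mem_inter_iff, Set.mem_iInter, Set.mem_compl_iff,
      Set.mem_sdiff]
    constructor
    · intro hx
      exact ⟨{n | x ∈ A' n}, ⟨hx0 x, hx⟩, fun m hm => hm, fun m hm => ⟨⟨0, hx0 x⟩, hm⟩⟩
    · rintro ⟨b, ⟨-, hb⟩, h1, h2⟩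
      convert hb using 1
      ext i
      by_cases hi : i + 1 ∈ b
      · exact iff_of_true (h1 (i + 1) hi) hi
      · exact iff_of_false (h2 (i + 1) hi).2 hi

theorem isCD_iff {X : Set (U.Star σ)} : U.IsCD X ↔
    ∃ (A : ℕ → Set (U.Star σ)) (B : Set (Set ℕ)), (∀ m, U.IsInternal (A m)) ∧
      X = {x | {m | x ∈ A m} ∈ B} := by
  constructor
  · rintro ⟨A, B, hA, rfl⟩
    -- The pattern b = ∅ contributes nothing to the defining union, since no point of ⋃ A n avoids
    -- every A n; left in B, it would add all points outside the A n.
    refine ⟨A, B \ {∅}, hA, ?_⟩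
    ext x
    simp only [Set.mem_iUnion, Set.mem_inter_iff, Set.mem_iInter, Set.mem_compl_iff, Set.mem_sdiff,
      Set.mem_ofPred, Set.mem_singleton_iff]
    constructor
    · rintro ⟨b, hb, h1, h2⟩
      have hS : {m | x ∈ A m} = b := by
        ext m
        by_cases hm : m ∈ b
        · exact iff_of_true (h1 m hm) hm
        · exact iff_of_false (h2 m hm).2 hm
      rw [hS]
      refine ⟨hb, ?_⟩
      rintro rfl
      obtain ⟨n, hn⟩ := (h2 0 (Set.notMem_empty 0)).1
      exact Set.notMem_empty n (hS ▸ (show n ∈ {m | x ∈ A m} from hn))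
    · rintro ⟨hB, hne⟩
      obtain ⟨n, hn⟩ := Set.nonempty_iff_ne_empty.2 hne
      exact ⟨_, hB, fun m hm => hm, fun m hm => ⟨⟨n, hn⟩, hm⟩⟩
  · rintro ⟨A, B, hA, rfl⟩
    exact isCD_of_isInternal_nat hA (· ∈ B)

theorem isCD_of_isInternal {ι : Type*} [Countable ι] {A : ι → Set (U.Star σ)}
    (hA : ∀ i, U.IsInternal (A i)) (Q : Set ι → Prop) : U.IsCD {x | Q {i | x ∈ A i}} := by
  classical
  obtain ⟨e, he⟩ := exists_injective_nat ι
  let A' : ℕ → Set (U.Star σ) := fun n => if h : ∃ i, e i = n then A h.choose else Set.univ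
  have hA' : ∀ n, U.IsInternal (A' n) := by
    intro n
    by_cases h : ∃ i, e i = n
    · simp only [A', dif_pos h]; exact hA _
    · simp only [A', dif_neg h]; exact isInternal_univ
  have key : ∀ i, A' (e i) = A i := by
    intro i
    have h : ∃ j, e j = e i := ⟨i, rfl⟩
    simp only [A', dif_pos h]
    rw [he h.choose_spec]
  have := isCD_of_isInternal_nat hA' (fun S => Q (e ⁻¹' S))
  convert this using 5
  simp [key]

/-- Countably determined sets are closed under arbitrary countable set-theoretic operations. -/
theorem isCD_of_isCD {ι : Type*} [Countable ι] {A : ι → Set (U.Star σ)}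
    (hA : ∀ i, U.IsCD (A i)) (Q : Set ι → Prop) : U.IsCD {x | Q {i | x ∈ A i}} := by
  choose A' B hA' hX using fun i => isCD_iff.1 (hA i)
  have := isCD_of_isInternal (ι := ι × ℕ) (A := fun p => A' p.1 p.2) (fun p => hA' p.1 p.2)
    (fun S => Q {i | {m | (i, m) ∈ S} ∈ B i})
  convert this using 5 with x
  ext i
  exact Set.ext_iff.1 (hX i) x

theorem IsInternal.isCD {X : Set (U.Star σ)} (h : U.IsInternal X) : U.IsCD X :=
  isCD_of_isInternal (ι := Unit) (fun _ => h) (fun S => () ∈ S)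

theorem IsCD.inter {X Y : Set (U.Star σ)} (hX : U.IsCD X) (hY : U.IsCD Y) : U.IsCD (X ∩ Y) := by
  exact isCD_of_isCD (ι := Bool) (A := fun b => if b then X else Y)
    (by rintro (_ | _) <;> assumption) (fun S => true ∈ S ∧ false ∈ S)

theorem IsCD.compl {X : Set (U.Star σ)} (hX : U.IsCD X) : U.IsCD Xᶜ :=
  isCD_of_isCD (ι := Unit) (fun _ => hX) (fun S => () ∉ S)

theorem isCD_iUnion {ι : Type*} [Countable ι] {A : ι → Set (U.Star σ)} (hA : ∀ i, U.IsCD (A i)) :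
    U.IsCD (⋃ i, A i) := by
  convert isCD_of_isCD hA (fun S => ∃ i, i ∈ S) using 1
  ext x
  simp

theorem IsCD.preimage {X : Set (U.Star τ)} (hX : U.IsCD X) {F : U.Star σ → U.Star τ}
    (hF : InternalFun F) : U.IsCD (F ⁻¹' X) := by
  obtain ⟨A, B, hA, rfl⟩ := isCD_iff.1 hX
  exact isCD_of_isInternal (A := fun m => F ⁻¹' A m) (fun m => (hA m).preimage hF) (· ∈ B)

/-! ### Piecewise internal maps -/

variable (U) in
/-- Maps that agree on `X` piecewise with countably many internal functions, the pieces being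
countably determined. -/
def CDMap (θ : U.Star σ → U.Star τ) (X : Set (U.Star σ)) : Prop :=
  ∃ (F : ℕ → U.Star σ → U.Star τ) (D : ℕ → Set (U.Star σ)), (∀ i, InternalFun (F i)) ∧
    (∀ i, U.IsCD (D i)) ∧ X ⊆ ⋃ i, D i ∧ ∀ i, ∀ x ∈ D i, x ∈ X → θ x = F i x

theorem nonempty_el (σ : StdType) : Nonempty σ.El := by
  induction σ with
  | nat => exact ⟨(0 : ℕ)⟩
  | prod _ _ h1 h2 => exact ⟨(Classical.choice h1, Classical.choice h2)⟩
  | pow _ _ => exact ⟨(∅ : Set _)⟩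

theorem cdMap_of_countable {ι : Type*} [Countable ι] {θ : U.Star σ → U.Star τ} {X : Set (U.Star σ)}
    {F : ι → U.Star σ → U.Star τ} {D : ι → Set (U.Star σ)} (hF : ∀ i, InternalFun (F i))
    (hD : ∀ i, U.IsCD (D i)) (hX : ∀ x ∈ X, ∃ i, x ∈ D i)
    (h : ∀ i, ∀ x ∈ D i, x ∈ X → θ x = F i x) : CDMap U θ X := by
  -- The index type can be empty only when X is, and then a constant map serves.
  rcases X.eq_empty_or_nonempty with rfl | ⟨x, hx⟩
  · exact ⟨fun _ => U.map fun _ => Classical.choice (nonempty_el τ), fun _ => Set.univ,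
      fun _ => internalFun_map _, fun _ => isInternal_univ.isCD, Set.empty_subset _,
      fun _ _ _ h => h.elim⟩
  · have : Nonempty ι := ⟨(hX x hx).choose⟩
    obtain ⟨e, he⟩ := exists_surjective_nat ι
    refine ⟨fun n => F (e n), fun n => D (e n), fun n => hF _, fun n => hD _, fun y hy => ?_,
      fun n => h _⟩
    obtain ⟨i, hi⟩ := hX y hy
    obtain ⟨n, rfl⟩ := he i
    exact Set.mem_iUnion.2 ⟨n, hi⟩

theorem InternalFun.cdMap {F : U.Star σ → U.Star τ} (hF : InternalFun F) (X : Set (U.Star σ)) :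
    CDMap U F X :=
  ⟨fun _ => F, fun _ => Set.univ, fun _ => hF, fun _ => isInternal_univ.isCD, fun _ _ => by simp,
    fun _ _ _ _ => rfl⟩

theorem CDMap.comp {θ : U.Star σ → U.Star τ} {θ' : U.Star τ → U.Star ρ} {X : Set (U.Star σ)}
    {Y : Set (U.Star τ)} (h' : CDMap U θ' Y) (h : CDMap U θ X) (hXY : Set.MapsTo θ X Y) :
    CDMap U (fun x => θ' (θ x)) X := by
  obtain ⟨F, D, hF, hD, hX, h⟩ := h
  obtain ⟨F', D', hF', hD', hY, h'⟩ := h'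
  refine cdMap_of_countable (ι := ℕ × ℕ) (F := fun p x => F' p.2 (F p.1 x))
    (D := fun p => D p.1 ∩ F p.1 ⁻¹' D' p.2) (fun p => (hF' _).comp (hF _))
    (fun p => (hD _).inter ((hD' _).preimage (hF _))) (fun x hx => ?_) (fun p x hx hxX => ?_)
  · obtain ⟨i, hi⟩ := Set.mem_iUnion.1 (hX hx)
    obtain ⟨j, hj⟩ := Set.mem_iUnion.1 (hY (hXY hx))
    rw [h i x hi hx] at hj
    exact ⟨(i, j), hi, hj⟩
  · have e := h _ x hx.1 hxX
    have hy := hXY hxX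
    rw [e] at hy
    simp only [e, h' _ _ hx.2 hy]

theorem CDMap.isCD_preimage {θ : U.Star σ → U.Star τ} {X : Set (U.Star σ)} {Y : Set (U.Star τ)}
    (h : CDMap U θ X) (hX : U.IsCD X) (hY : U.IsCD Y) : U.IsCD (X ∩ θ ⁻¹' Y) := by
  obtain ⟨F, D, hF, hD, hXD, h⟩ := h
  convert isCD_iUnion (A := fun i => (X ∩ D i) ∩ F i ⁻¹' Y)
    (fun i => (hX.inter (hD i)).inter (hY.preimage (hF i))) using 1
  ext x
  simp only [Set.mem_inter_iff, Set.mem_preimage, Set.mem_iUnion]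
  constructor
  · rintro ⟨hx, hy⟩
    obtain ⟨i, hi⟩ := Set.mem_iUnion.1 (hXD hx)
    exact ⟨i, ⟨hx, hi⟩, h i x hi hx ▸ hy⟩
  · rintro ⟨i, ⟨hx, hi⟩, hy⟩
    exact ⟨hx, (h i x hi hx).symm ▸ hy⟩

theorem internalFun_fst : InternalFun (U := U) (U.map (σ := .prod σ τ) (τ := σ) Prod.fst) :=
  internalFun_map _

theorem internalFun_snd : InternalFun (U := U) (U.map (σ := .prod σ τ) (τ := τ) Prod.snd) :=
  internalFun_map _

/-- Over each piece the graph is the equality set of two internal maps, cut down to a CD set of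
first coordinates; the whole graph is a countable union of these. -/
theorem CDMap.cdLe {θ : U.Star σ → U.Star τ} {X : Set (U.Star σ)} {Y : Set (U.Star τ)}
    (h : CDMap U θ X) (hX : U.IsCD X) (hm : Set.MapsTo θ X Y) (hi : Set.InjOn θ X) :
    U.CDLe X Y := by
  refine ⟨θ, hm, hi, ?_⟩
  obtain ⟨F, D, hF, hD, hXD, h⟩ := h
  convert isCD_iUnion (A := fun i => U.map (σ := .prod σ τ) (τ := σ) Prod.fst ⁻¹' (X ∩ D i) ∩
    {p | F i (U.map (σ := .prod σ τ) (τ := σ) Prod.fst p) =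
      U.map (σ := .prod σ τ) (τ := τ) Prod.snd p})
    (fun i => ((hX.inter (hD i)).preimage internalFun_fst).inter
      (((hF i).comp internalFun_fst).isInternal_eq internalFun_snd).isCD) using 1
  ext p
  simp only [Set.mem_image, Set.mem_iUnion, Set.mem_inter_iff, Set.mem_preimage, Set.mem_ofPred]
  constructor
  · rintro ⟨x, hx, rfl⟩
    obtain ⟨i, hi⟩ := Set.mem_iUnion.1 (hXD hx)
    rw [U.map_fst_pair, U.map_snd_pair]
    exact ⟨i, ⟨hx, hi⟩, (h i x hi hx).symm⟩
  · rintro ⟨i, ⟨hx, hi⟩, e⟩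
    refine ⟨_, hx, ?_⟩
    rw [h i _ hi hx, e, U.pair_eta]

/-- Internal choice. -/
theorem IsInternal.exists_choice {P : Set (U.Star (.prod σ τ))} (hP : U.IsInternal P) :
    ∃ F : U.Star σ → U.Star τ, InternalFun F ∧ ∀ x y, U.pair x y ∈ P → U.pair x (F x) ∈ P := by
  classical
  obtain ⟨S, rfl⟩ := isInternal_iff.1 hP
  let f : Set (σ.El × τ.El) → σ.El → τ.El := fun S x =>
    if h : ∃ y, (x, y) ∈ S then h.choose else Classical.choice (nonempty_el τ)
  refine ⟨app (ρ := .pow (.prod σ τ)) f S, internalFun_app _ _, fun x y h => ?_⟩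
  have h1 : U.Holds (σ := .prod (.pow (.prod σ τ)) (.prod σ τ)) (U.pair S (U.pair x y))
      (fun p => (p.2.1, f p.1 p.2.1) ∈ p.1) := by
    refine Holds.mono h fun p hp => ?_
    have h2 : ∃ y, (p.2.1, y) ∈ p.1 := ⟨p.2.2, hp⟩
    simp only [f, dif_pos h2]
    exact h2.choose_spec
  have e : U.pair S (U.pair x (app (ρ := .pow (.prod σ τ)) f S x)) =
      U.map (σ := .prod (.pow (.prod σ τ)) (.prod σ τ)) (τ := .prod (.pow (.prod σ τ)) (.prod σ τ))
        (fun p => (p.1, (p.2.1, f p.1 p.2.1))) (U.pair S (U.pair x y)) := by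
    rw [← pair_map (σ := .prod (.pow (.prod σ τ)) (.prod σ τ)) (τ := .pow (.prod σ τ))
      (ρ := .prod σ τ) (fun p => p.1) (fun p => (p.2.1, f p.1 p.2.1)), map_fst,
      ← pair_map (σ := .prod (.pow (.prod σ τ)) (.prod σ τ)) (τ := σ)
      (ρ := τ) (fun p => p.2.1) (fun p => f p.1 p.2.1),
      ← map_map (σ := .prod (.pow (.prod σ τ)) (.prod σ τ)) (τ := .prod σ τ) (ρ := σ)
        (fun p => p.1) (fun p => p.2), map_snd, map_fst]
    have : U.pair S x = U.map (σ := .prod (.pow (.prod σ τ)) (.prod σ τ))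
        (τ := .prod (.pow (.prod σ τ)) σ) (fun p => (p.1, p.2.1)) (U.pair S (U.pair x y)) := by
      rw [← pair_map (σ := .prod (.pow (.prod σ τ)) (.prod σ τ)) (τ := .pow (.prod σ τ))
        (ρ := σ) (fun p => p.1) (fun p => p.2.1), map_fst,
        ← map_map (σ := .prod (.pow (.prod σ τ)) (.prod σ τ)) (τ := .prod σ τ) (ρ := σ)
        (fun p => p.1) (fun p => p.2), map_snd, map_fst]
    rw [app, this, map_map (σ := .prod (.pow (.prod σ τ)) (.prod σ τ))]
  change U.Holds (σ := .prod (.pow (.prod σ τ)) (.prod σ τ)) _ _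
  rw [e, holds_map]
  exact h1

/-! ### Decomposition of CD injections into internal partial injections -/

theorem IsInternal.forall_lt {A : ℕ → Set (U.Star σ)} (hA : ∀ m, U.IsInternal (A m)) (k : ℕ) :
    U.IsInternal {x | ∀ m < k, x ∈ A m} := by
  induction k with
  | zero => simpa using isInternal_univ
  | succ k ih =>
    convert ih.inter (hA k) using 1
    ext x
    simp only [Set.mem_ofPred, Set.mem_inter_iff, Nat.lt_succ_iff_lt_or_eq]
    exact ⟨fun h => ⟨fun m hm => h m (Or.inl hm), h k (Or.inr rfl)⟩,
      fun h m hm => hm.elim (h.1 m) fun e => e ▸ h.2⟩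

theorem IsInternal.iff_const {A : Set (U.Star σ)} (hA : U.IsInternal A) (p : Prop) :
    U.IsInternal {x | x ∈ A ↔ p} := by
  by_cases hp : p
  · simpa [hp] using hA
  · simp only [hp, iff_false]
    exact hA.compl

/-- The graph of a countably determined injection is covered by countably many graphs of internal
partial injections. -/
theorem exists_internal_of_cdGraph {θ : U.Star σ → U.Star τ} {X : Set (U.Star σ)}
    (hi : Set.InjOn θ X) (hθ : U.IsCD ((fun x => U.pair x (θ x)) '' X)) :
    ∃ (ι : Type) (_ : Countable ι) (F : ι → U.Star σ → U.Star τ) (E : ι → Set (U.Star σ)),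
      (∀ i, InternalFun (F i)) ∧ (∀ i, U.IsInternal (E i)) ∧ (∀ i, Set.InjOn (F i) (E i)) ∧
      ∀ x ∈ X, ∃ i, x ∈ E i ∧ θ x = F i x := by
  obtain ⟨A, B, hA, hG⟩ := isCD_iff.1 hθ
  let P : ℕ × Finset ℕ → Set (U.Star (.prod σ τ)) :=
    fun s => {p | ∀ m < s.1, (p ∈ A m ↔ m ∈ s.2)}
  have hP : ∀ s, U.IsInternal (P s) := fun s =>
    IsInternal.forall_lt (fun m => (hA m).iff_const (m ∈ s.2)) s.1
  choose F hF hFP using fun s => (hP s).exists_choice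
  let fst := U.map (σ := .prod σ τ) (τ := σ) Prod.fst
  let snd := U.map (σ := .prod σ τ) (τ := τ) Prod.snd
  -- Both projections are injective on a good cell, so a good cell is the graph of an internal
  -- partial injection.
  let good : ℕ × Finset ℕ → Prop := fun s =>
    ∀ p ∈ P s, ∀ q ∈ P s, fst p = fst q ∨ snd p = snd q → p = q
  have hsig : ∀ x ∈ X, ∃ s, good s ∧ U.pair x (θ x) ∈ P s := by
    intro x hx
    classical
    let t : ℕ → ℕ × Finset ℕ := fun k => (k, (Finset.range k).filter (U.pair x (θ x) ∈ A ·))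
    have ht : ∀ k p, p ∈ P (t k) ↔ ∀ m < k, (p ∈ A m ↔ U.pair x (θ x) ∈ A m) := by
      intro k p
      refine forall₂_congr fun m hm => ?_
      simp only [t, Finset.mem_filter, Finset.mem_range] at hm ⊢
      simp [hm]
    -- If no finite part of the pattern of (x, θ x) gives a good cell, saturation yields two
    -- distinct points with the full pattern of (x, θ x) and a common coordinate. Membership in the
    -- graph depends only on the pattern, so both lie on the graph of θ, which is an injective
    -- function.
    by_contra hno
    push Not at hno
    let fst₂ := U.map (σ := .prod (.prod σ τ) (.prod σ τ)) (τ := .prod σ τ) Prod.fst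
    let snd₂ := U.map (σ := .prod (.prod σ τ) (.prod σ τ)) (τ := .prod σ τ) Prod.snd
    have hsat := exists_forall_mem (U := U) (σ := .prod (.prod σ τ) (.prod σ τ))
      (A := fun k => fst₂ ⁻¹' P (t k) ∩ snd₂ ⁻¹' P (t k) ∩
        ({r | fst (fst₂ r) = fst (snd₂ r)}ᶜ ∩ {r | snd (fst₂ r) = snd (snd₂ r)}ᶜ)ᶜ ∩
        {r | fst₂ r = snd₂ r}ᶜ) ?_ ?_
    · obtain ⟨r, hr⟩ := hsat
      have hmem : ∀ p, (∀ k, p ∈ P (t k)) → ∃ y ∈ X, U.pair y (θ y) = p := by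
        intro p hp
        have h1 : U.pair x (θ x) ∈ (fun x => U.pair x (θ x)) '' X := ⟨x, hx, rfl⟩
        have h2 : p ∈ (fun x => U.pair x (θ x)) '' X := by
          rw [hG] at h1 ⊢
          have : {m | p ∈ A m} = {m | U.pair x (θ x) ∈ A m} := by
            ext m
            exact (ht (m + 1) p).1 (hp _) m (by omega)
          change {m | p ∈ A m} ∈ B
          rw [this]
          exact h1
        exact h2
      obtain ⟨y, hy, e⟩ := hmem (fst₂ r) fun k => (hr k).1.1.1
      obtain ⟨y', hy', e'⟩ := hmem (snd₂ r) fun k => (hr k).1.1.2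
      have h1 := (hr 0).1.2
      have h2 := (hr 0).2
      simp only [Set.mem_compl_iff, Set.mem_inter_iff, Set.mem_ofPred, ← e, ← e', fst, snd,
        U.map_fst_pair, U.map_snd_pair] at h1 h2
      have : y = y' := by
        by_contra hne
        exact h1 ⟨hne, fun h => hne (hi hy hy' h)⟩
      exact h2 (by rw [this])
    · intro k
      have i1 : InternalFun fst₂ := internalFun_map _
      have i2 : InternalFun snd₂ := internalFun_map _
      have i3 : InternalFun fst := internalFun_map _
      have i4 : InternalFun snd := internalFun_map _
      exact ((((hP _).preimage i1).inter ((hP _).preimage i2)).inter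
        ((((i3.comp i1).isInternal_eq (i3.comp i2)).compl.inter
          ((i4.comp i1).isInternal_eq (i4.comp i2)).compl).compl)).inter
        (i1.isInternal_eq i2).compl
    · intro n
      have hbad : ¬ good (t n) := fun hg => hno _ hg ((ht n _).2 fun m _ => Iff.rfl)
      simp only [good, not_forall] at hbad
      obtain ⟨p, hp, q, hq, hpq, hne⟩ := hbad
      refine ⟨U.pair p q, fun m hm => ⟨⟨⟨?_, ?_⟩, ?_⟩, ?_⟩⟩
      · simp only [Set.mem_preimage, fst₂, U.map_fst_pair]
        exact (ht m p).2 fun i hi => (ht n p).1 hp i (by omega)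
      · simp only [Set.mem_preimage, snd₂, U.map_snd_pair]
        exact (ht m q).2 fun i hi => (ht n q).1 hq i (by omega)
      · simp only [Set.mem_compl_iff, Set.mem_inter_iff, Set.mem_ofPred, fst₂, snd₂,
          U.map_fst_pair, U.map_snd_pair]
        tauto
      · simpa only [Set.mem_compl_iff, Set.mem_ofPred, fst₂, snd₂,
          U.map_fst_pair, U.map_snd_pair] using hne
  refine ⟨{s // good s}, inferInstance, fun s => F s.1, fun s => {x | U.pair x (F s.1 x) ∈ P s.1},
    fun s => hF _, fun s => (hP _).preimage (internalFun_id.pair (hF _)), ?_, ?_⟩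
  · rintro ⟨s, hs⟩ x hx x' hx' he
    refine (pair_inj (hs _ hx _ hx' (Or.inr ?_))).1
    simpa only [snd, U.map_snd_pair] using he
  · intro x hx
    obtain ⟨s, hs, hxs⟩ := hsig x hx
    refine ⟨⟨s, hs⟩, hFP s x _ hxs, ?_⟩
    refine (pair_inj (hs _ hxs _ (hFP s x _ hxs) (Or.inl ?_))).2
    simp only [fst, U.map_fst_pair]

/-- Each piece is the set where an internal F i agrees with θ on X, that is, the preimage of the CD
graph under x ↦ (x, F i x). -/
theorem isCD_of_cdGraph {θ : U.Star σ → U.Star τ} {X : Set (U.Star σ)}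
    (hi : Set.InjOn θ X) (hθ : U.IsCD ((fun x => U.pair x (θ x)) '' X)) :
    U.IsCD X ∧ CDMap U θ X := by
  obtain ⟨ι, _, F, E, hF, -, -, h⟩ := exists_internal_of_cdGraph hi hθ
  have hD : ∀ i, U.IsCD ((fun x => U.pair x (F i x)) ⁻¹' ((fun x => U.pair x (θ x)) '' X)) :=
    fun i => hθ.preimage (internalFun_id.pair (hF i))
  have hmem : ∀ i x, x ∈ (fun x => U.pair x (F i x)) ⁻¹' ((fun x => U.pair x (θ x)) '' X) ↔
      x ∈ X ∧ θ x = F i x := by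
    intro i x
    constructor
    · rintro ⟨y, hy, e⟩
      obtain ⟨rfl, e⟩ := pair_inj e
      exact ⟨hy, e⟩
    · rintro ⟨hx, e⟩
      exact ⟨x, hx, by simp only [e]⟩
  constructor
  · convert isCD_iUnion hD using 1
    ext x
    simp only [Set.mem_iUnion, hmem]
    exact ⟨fun hx => (h x hx).imp fun i hi => ⟨hx, hi.2⟩, fun ⟨i, hi⟩ => hi.1⟩
  · exact cdMap_of_countable hF hD (fun x hx => (h x hx).imp fun i hi => (hmem i x).2 ⟨hx, hi.2⟩)
      fun i x hx _ => ((hmem i x).1 hx).2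

theorem CDLe.trans {X : Set (U.Star σ)} {Y : Set (U.Star τ)} {Z : Set (U.Star ρ)}
    (h : U.CDLe X Y) (h' : U.CDLe Y Z) : U.CDLe X Z := by
  obtain ⟨θ, hm, hi, hg⟩ := h
  obtain ⟨θ', hm', hi', hg'⟩ := h'
  obtain ⟨hX, hθ⟩ := isCD_of_cdGraph hi hg
  exact ((isCD_of_cdGraph hi' hg').2.comp hθ hm).cdLe hX (hm'.comp hm) (hi'.comp hi hm)

/-! ### Joint parameters -/

/-- Writing several hyperelements as values of standard maps at one w turns a joint statement about
them into a single `Holds w`, where pointwise reasoning applies. -/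
theorem exists_joint₂ (x : U.Star σ) (y : U.Star τ) : ∃ w : U.Star (.prod σ τ),
    U.map (σ := .prod σ τ) (fun p => p.1) w = x ∧ U.map (σ := .prod σ τ) (fun p => p.2) w = y :=
  ⟨U.pair x y, map_fst x y, map_snd x y⟩

theorem exists_joint₃ (x : U.Star σ) (y : U.Star τ) (u : U.Star ρ) :
    ∃ w : U.Star (.prod σ (.prod τ ρ)), U.map (σ := .prod σ (.prod τ ρ)) (fun p => p.1) w = x ∧
      U.map (σ := .prod σ (.prod τ ρ)) (fun p => p.2.1) w = y ∧
      U.map (σ := .prod σ (.prod τ ρ)) (fun p => p.2.2) w = u := by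
  obtain ⟨v, rfl, rfl⟩ := exists_joint₂ y u
  obtain ⟨w, rfl, rfl⟩ := exists_joint₂ x v
  exact ⟨w, rfl, (map_map (σ := .prod σ (.prod τ ρ)) (τ := .prod τ ρ) _ _ _).symm,
    (map_map (σ := .prod σ (.prod τ ρ)) (τ := .prod τ ρ) _ _ _).symm⟩

theorem exists_joint₄ (x : U.Star σ) (y : U.Star τ) (u : U.Star ρ) (v : U.Star υ) :
    ∃ w : U.Star (.prod σ (.prod τ (.prod ρ υ))),
      U.map (σ := .prod σ (.prod τ (.prod ρ υ))) (fun p => p.1) w = x ∧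
      U.map (σ := .prod σ (.prod τ (.prod ρ υ))) (fun p => p.2.1) w = y ∧
      U.map (σ := .prod σ (.prod τ (.prod ρ υ))) (fun p => p.2.2.1) w = u ∧
      U.map (σ := .prod σ (.prod τ (.prod ρ υ))) (fun p => p.2.2.2) w = v := by
  obtain ⟨t, rfl, rfl, rfl⟩ := exists_joint₃ y u v
  obtain ⟨w, rfl, rfl⟩ := exists_joint₂ x t
  exact ⟨w, rfl,
    (map_map (σ := .prod σ (.prod τ (.prod ρ υ))) (τ := .prod τ (.prod ρ υ)) _ _ _).symm,
    (map_map (σ := .prod σ (.prod τ (.prod ρ υ))) (τ := .prod τ (.prod ρ υ))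
      (fun p => p.2.1) (fun p => p.2) _).symm,
    (map_map (σ := .prod σ (.prod τ (.prod ρ υ))) (τ := .prod τ (.prod ρ υ))
      (fun p => p.2.2) (fun p => p.2) _).symm⟩

theorem rel_map {P : ρ.El → τ.El → Prop} {f : σ.El → ρ.El} {g : σ.El → τ.El} {w : U.Star σ} :
    U.Rel P (U.map f w) (U.map g w) ↔ U.Holds w (fun a => P (f a) (g a)) := by
  rw [Rel, pair_map, holds_map]

theorem app_map {F : ρ.El → τ.El → υ.El} {f : σ.El → ρ.El} {g : σ.El → τ.El} {w : U.Star σ} :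
    app F (U.map f w) (U.map g w) = U.map (fun a => F (f a) (g a)) w := by
  rw [app, pair_map, map_map (τ := .prod ρ τ)]

theorem hlt_map {f g : σ.El → ℕ} {w : U.Star σ} :
    U.hlt (U.map (τ := .nat) f w) (U.map (τ := .nat) g w) ↔ U.Holds w (fun a => f a < g a) :=
  rel_map (ρ := .nat) (τ := .nat) (P := fun a b : ℕ => a < b)

theorem hnat_eq_map (n : ℕ) (w : U.Star σ) :
    U.hnat n = U.map (τ := .nat) (fun _ => n) w := (map_const (τ := .nat) n w).symm

/-! ### Coding of finite functions and of sequences of internal sets -/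

/-- The function with code `n`. -/
def evalCode (n y : ℕ) : ℕ := ((Encodable.decode n : Option (List ℕ)).getD []).getD y 0

theorem exists_evalCode (f : ℕ → ℕ) {V : Set ℕ} (hV : V.Finite) :
    ∃ n, ∀ y ∈ V, evalCode n y = f y := by
  obtain ⟨N, hN⟩ := hV.bddAbove
  refine ⟨Encodable.encode ((List.range (N + 1)).map f), fun y hy => ?_⟩
  have : y < N + 1 := Nat.lt_succ_of_le (hN hy)
  simp [evalCode, List.getD_eq_getElem?_getD, List.getElem?_map, List.getElem?_range this]

/-- Finitely many sections of H can be prescribed by overwriting them one after another; saturation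
then prescribes all standard sections at once. Nothing is claimed about nonstandard sections. -/
theorem exists_code {A : ℕ → Set (U.Star σ)} (hA : ∀ m, U.IsInternal (A m)) :
    ∃ H : U.Star (.pow (.prod .nat σ)), ∀ m y,
      y ∈ A m ↔ U.Rel (ρ := .pow (.prod .nat σ)) (fun H y => ((m, y) : ℕ × σ.El) ∈ H) H y := by
  choose S hS using fun m => isInternal_iff.1 (hA m)
  let C : ℕ → Set σ.El → Set (ℕ × σ.El) → Prop := fun m a H => ∀ y, y ∈ a ↔ (m, y) ∈ H
  have hfin : ∀ n, ∃ H, ∀ m ≤ n, U.Rel (ρ := .pow σ) (σ := .pow (.prod .nat σ)) (C m) (S m) H := by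
    intro n
    let step : ℕ → Set σ.El → Set (ℕ × σ.El) → Set (ℕ × σ.El) :=
      fun n a H => {q | (q.1 = n ∧ q.2 ∈ a) ∨ (q.1 ≠ n ∧ q ∈ H)}
    have hnew : ∀ (n : ℕ) H, U.Rel (ρ := .pow σ) (σ := .pow (.prod .nat σ)) (C n) (S n)
        (app (ρ := .pow σ) (σ := .pow (.prod .nat σ)) (τ := .pow (.prod .nat σ)) (step n) (S n) H) := by
      intro n H
      rw [rel_app]
      refine holds_of_forall fun p y => ?_
      simp [step]
    induction n with
    | zero =>
      refine ⟨app (ρ := .pow σ) (σ := .pow (.prod .nat σ)) (τ := .pow (.prod .nat σ)) (step 0) (S 0)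
        (U.star (σ := .pow (.prod .nat σ)) (∅ : Set (ℕ × σ.El))), fun m hm => ?_⟩
      obtain rfl : m = 0 := by omega
      exact hnew _ _
    | succ n ih =>
      obtain ⟨H, hH⟩ := ih
      refine ⟨app (ρ := .pow σ) (σ := .pow (.prod .nat σ)) (τ := .pow (.prod .nat σ))
        (step (n + 1)) (S (n + 1)) H, fun m hm => ?_⟩
      rcases Nat.le_succ_iff_eq_or_le.1 hm with rfl | hm
      · exact hnew _ _
      · have h := hH m hm
        obtain ⟨w, h1, h2, h3⟩ := exists_joint₃ (S m) (S (n + 1)) H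
        rw [← h1, ← h3, rel_map] at h
        rw [← h1, ← h2, ← h3, app_map, rel_map]
        refine h.mono fun p hp y => ?_
        have : m ≠ n + 1 := by omega
        simpa [step, this] using hp y
  obtain ⟨H, hH⟩ := exists_forall_mem (fun m => isInternal_rel (U := U) (ρ := .pow σ)
    (σ := .pow (.prod .nat σ)) (C m) (S m)) hfin
  refine ⟨H, fun m y => ?_⟩
  have h : U.Rel (ρ := .pow σ) (σ := .pow (.prod .nat σ)) (C m) (S m) H := hH m
  rw [hS]
  change U.Rel (ρ := .pow σ) (fun A b => b ∈ A) (S m) y ↔ _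
  obtain ⟨w, h1, h2, rfl⟩ := exists_joint₃ (S m) H y
  rw [← h1, ← h2, rel_map] at h
  rw [← h1, ← h2, rel_map, rel_map, ← holds_iff]
  exact h.mono fun p hp => hp _

/-! ### Internal injections respecting countable chains -/

/-- The injection is built from the innermost pair outwards: once V 1 is placed inside W 0, there
remain |W 0| - |V 1| free values for the |V 0| - |V 1| new points. -/
theorem exists_injOn_chain (K : ℕ) : ∀ V W : ℕ → Set ℕ, (V 0).Finite → (W 0).Finite →
    (∀ k < K, V (k + 1) ⊆ V k) → (∀ k < K, W (k + 1) ⊆ W k) →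
    (∀ k ≤ K, (V k).ncard ≤ (W k).ncard) →
    ∃ f : ℕ → ℕ, Set.InjOn f (V 0) ∧ ∀ k ≤ K, Set.MapsTo f (V k) (W k) := by
  induction K with
  | zero =>
    intro V W hV hW _ _ h
    obtain ⟨f, hf, hi⟩ := Set.Finite.exists_injOn_of_encard_le (t := W 0) hV (by
      rw [← hV.cast_ncard_eq, ← hW.cast_ncard_eq]; exact_mod_cast h 0 le_rfl)
    refine ⟨f, hi, fun k hk => ?_⟩
    obtain rfl : k = 0 := by omega
    exact hf
  | succ K ih =>
    intro V W hV hW hVm hWm h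
    have hV1 : (V 1).Finite := hV.subset (hVm 0 (by omega))
    have hW1 : (W 1).Finite := hW.subset (hWm 0 (by omega))
    obtain ⟨f, hi, hf⟩ := ih (fun k => V (k + 1)) (fun k => W (k + 1)) hV1 hW1
      (fun k hk => hVm (k + 1) (by omega)) (fun k hk => hWm (k + 1) (by omega))
      (fun k hk => h (k + 1) (by omega))
    have hfV : f '' V 1 ⊆ W 0 := by
      rintro _ ⟨x, hx, rfl⟩
      exact hWm 0 (by omega) (hf 0 (by omega) hx)
    obtain ⟨g, hg, hgi⟩ := Set.Finite.exists_injOn_of_encard_le (s := V 0 \ V 1)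
      (t := W 0 \ f '' V 1) (hV.subset Set.sdiff_subset) (by
        rw [← (hV.subset Set.sdiff_subset).cast_ncard_eq,
          ← (hW.subset Set.sdiff_subset).cast_ncard_eq,
          Set.ncard_sdiff (hVm 0 (by omega)) hV1, Set.ncard_sdiff hfV (hV1.image f),
          hi.ncard_image]
        exact_mod_cast Nat.sub_le_sub_right (h 0 (by omega)) _)
    classical
    refine ⟨fun x => if x ∈ V 1 then f x else g x, ?_, ?_⟩
    · intro x hx y hy e
      by_cases h1 : x ∈ V 1 <;> by_cases h2 : y ∈ V 1
      · simp only [h1, h2, if_true] at e; exact hi h1 h2 e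
      · simp only [h1, h2, if_true, if_false] at e
        exact absurd ⟨x, h1, e⟩ (hg ⟨hy, h2⟩).2
      · simp only [h1, h2, if_true, if_false] at e
        exact absurd ⟨y, h2, e.symm⟩ (hg ⟨hx, h1⟩).2
      · simp only [h1, h2, if_false] at e; exact hgi ⟨hx, h1⟩ ⟨hy, h2⟩ e
    · have hsub : ∀ k ≤ K, V (k + 1) ⊆ V 1 := by
        intro k
        induction k with
        | zero => exact fun _ => subset_rfl
        | succ k ihk => exact fun hk => (hVm (k + 1) (by omega)).trans (ihk (by omega))
      rintro (_ | k) hk x hx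
      · by_cases h1 : x ∈ V 1
        · simp only [h1, if_true]; exact hfV ⟨x, h1, rfl⟩
        · simp only [h1, if_false]; exact (hg ⟨hx, h1⟩).1
      · have h1 : x ∈ V 1 := hsub k (by omega) hx
        simp only [h1, if_true]
        exact hf k (by omega) hx

/-- Internal functions on an internally finite set have hyperinteger codes, so respecting one level
of the chain is an internal condition on the code. `exists_injOn_chain` meets finitely many levels
and saturation all standard ones. In applications F carries the intersection of the V k into that of
the W k. -/
theorem exists_internal_injOn_chain {z : U.Star ρ} {V W : ℕ → ρ.El → Set ℕ}
    (hfin : U.Holds z (fun a => (V 0 a).Finite ∧ (W 0 a).Finite))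
    (hV : ∀ k, U.Holds z (fun a => V (k + 1) a ⊆ V k a))
    (hW : ∀ k, U.Holds z (fun a => W (k + 1) a ⊆ W k a))
    (hcard : ∀ k, U.Holds z (fun a => (V k a).ncard ≤ (W k a).ncard)) :
    ∃ F : U.Star .nat → U.Star .nat, InternalFun F ∧
      Set.InjOn F {x | U.Rel (σ := .nat) (fun a y => y ∈ V 0 a) z x} ∧
      ∀ k x, U.Rel (σ := .nat) (fun a y => y ∈ V k a) z x →
        U.Rel (σ := .nat) (fun a y => y ∈ W k a) z (F x) := by
  let C : ℕ → ρ.El → ℕ → Prop := fun k a n =>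
    Set.InjOn (evalCode n) (V 0 a) ∧ Set.MapsTo (evalCode n) (V k a) (W k a)
  obtain ⟨n, hn⟩ := exists_forall_mem (U := U) (A := fun k => {n | U.Rel (σ := .nat) (C k) z n})
    (fun k => isInternal_rel (σ := .nat) (C k) z) (by
      intro K
      have h1 : U.Holds z (fun a => ∃ n : ℕ, ∀ k ≤ K, C k a n) := by
        refine (holds_and.2 ⟨hfin, holds_forall_lt.2 fun k (_ : k < K) => hV k⟩).mono₃
          (holds_forall_lt.2 fun k (_ : k < K) => hW k)
          (holds_forall_le.2 fun k (_ : k ≤ K) => hcard k) ?_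
        rintro a ⟨⟨f1, f2⟩, h1⟩ h2 h3
        obtain ⟨f, hi, hf⟩ := exists_injOn_chain K (fun k => V k a) (fun k => W k a) f1 f2 h1 h2 h3
        obtain ⟨n, hn⟩ := exists_evalCode f f1
        refine ⟨n, fun k hk => ⟨hi.congr fun y hy => (hn y hy).symm, fun y hy => ?_⟩⟩
        have hy0 : y ∈ V 0 a := by
          have hsub : ∀ k ≤ K, V k a ⊆ V 0 a := by
            intro k
            induction k with
            | zero => exact fun _ => subset_rfl
            | succ k ihk => exact fun hk => (h1 k (by omega)).trans (ihk (by omega))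
          exact hsub k hk hy
        rw [hn y hy0]
        exact hf k hk hy
      obtain ⟨n, hn⟩ := (holds_exists (τ := .nat)).1 h1
      refine ⟨n, fun m hm => ?_⟩
      exact (holds_forall_le (σ := .prod ρ .nat) (P := fun k p => C k p.1 p.2)).1 hn m hm)
  refine ⟨app (ρ := .nat) (σ := .nat) (τ := .nat) evalCode n, internalFun_app _ _, ?_, ?_⟩
  · intro x hx y hy e
    have h0 : U.Rel (σ := .nat) (C 0) z n := hn 0
    change U.Rel (σ := .nat) (fun a y => y ∈ V 0 a) z x at hx
    change U.Rel (σ := .nat) (fun a y => y ∈ V 0 a) z y at hy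
    obtain ⟨w, rfl, rfl, rfl, rfl⟩ := exists_joint₄ z n x y
    rw [rel_map] at hx hy h0
    rw [app_map, app_map, ← holds_eq] at e
    rw [← holds_eq]
    refine (holds_and.2 ⟨hx, hy⟩).mono₃ h0 e ?_
    rintro a ⟨h1, h2⟩ h3 h4
    exact h3.1 h1 h2 h4
  · intro k x hx
    have h0 : U.Rel (σ := .nat) (C k) z n := hn k
    obtain ⟨w, rfl, rfl, rfl⟩ := exists_joint₃ z n x
    rw [rel_map] at hx h0
    rw [app_map, rel_map]
    exact h0.mono₂ hx fun a h h' => h.2 h'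

/-! ### Small internal sets -/

variable (U) in
/-- The internal set `Z` is finite in the internal sense and `|Z| / 2 ^ d` is infinitesimal. -/
def IsSmall (d : U.Star .nat) (Z : U.Star (.pow .nat)) : Prop :=
  ∀ m : ℕ, U.Rel (ρ := .nat) (σ := .pow .nat)
    (fun (d : ℕ) (Z : Set ℕ) => Z.Finite ∧ Z.ncard * m ≤ 2 ^ d) d Z

theorem ncard_biUnion_mul_le {T : ℕ → Set ℕ} {K m κ : ℕ}
    (h : ∀ i ≤ K, (T i).ncard * ((K + 1) * m) ≤ κ) : (⋃ i ∈ Finset.range (K + 1), T i).ncard * m ≤ κ := by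
  have h1 : (⋃ i ∈ Finset.range (K + 1), T i).ncard ≤ ∑ i ∈ Finset.range (K + 1), (T i).ncard :=
    Finset.set_ncard_biUnion_le _ _
  have h2 : (∑ i ∈ Finset.range (K + 1), (T i).ncard) * ((K + 1) * m) ≤ (K + 1) * κ := by
    rw [Finset.sum_mul]
    refine (Finset.sum_le_card_nsmul _ _ κ fun i hi => h i ?_).trans (by simp)
    simpa [Nat.lt_succ_iff] using hi
  have h3 : (K + 1) * ((∑ i ∈ Finset.range (K + 1), (T i).ncard) * m) ≤ (K + 1) * κ := by
    linarith [h2]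
  exact (Nat.mul_le_mul_right m h1).trans (Nat.le_of_mul_le_mul_left h3 (Nat.succ_pos K))

/-- Finite unions of small sets are small, and saturation passes from finite to countable families.
-/
theorem exists_isSmall_cover {d : U.Star .nat} {z : U.Star ρ} {δ : ρ.El → ℕ}
    (hd : U.map (τ := .nat) δ z = d) {T : ℕ → ρ.El → Set ℕ}
    (hT : ∀ i m, U.Holds z (fun a => (T i a).Finite ∧ (T i a).ncard * m ≤ 2 ^ δ a)) :
    ∃ Z, U.IsSmall d Z ∧ ∀ i y, U.Rel (σ := .nat) (fun a y => y ∈ T i a) z y → y ∈ U.ext Z := by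
  let C : ℕ → ρ.El → Set ℕ → Prop := fun m a Z => T m a ⊆ Z ∧ Z.Finite ∧ Z.ncard * m ≤ 2 ^ δ a
  obtain ⟨Z, hZ⟩ := exists_forall_mem (U := U) (A := fun m => {Z | U.Rel (σ := .pow .nat) (C m) z Z})
    (fun m => isInternal_rel (σ := .pow .nat) (C m) z) (by
      intro K
      refine ⟨U.map (τ := .pow .nat) (fun a => ⋃ i ∈ Finset.range (K + 1), T i a) z, fun m hm => ?_⟩
      have hz := rel_map (U := U) (τ := .pow .nat) (P := C m) (f := fun a => a)
        (g := fun a => ⋃ i ∈ Finset.range (K + 1), T i a) (w := z)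
      rw [U.map_id] at hz
      refine hz.2 ?_
      -- The multiplier (K + 1) * m for each of K + 1 sets leaves the multiplier m for their union.
      refine (holds_forall_le.2 fun i (_ : i ≤ K) => hT i ((K + 1) * m)).mono fun a h => ?_
      refine ⟨Set.subset_biUnion_of_mem (u := fun i => T i a) (by simp; omega), ?_, ?_⟩
      · exact Set.Finite.biUnion (Finset.finite_toSet _) fun i hi =>
          (h i (by simp at hi; omega)).1
      · exact ncard_biUnion_mul_le fun i hi => (h i hi).2)
  have hZ' : ∀ m, U.Rel (σ := .pow .nat) (C m) z Z := hZ
  refine ⟨Z, fun m => ?_, fun i y hy => ?_⟩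
  · have h := hZ' m
    subst hd
    obtain ⟨w, rfl, rfl⟩ := exists_joint₂ z Z
    rw [rel_map] at h
    rw [map_map (σ := .prod ρ (.pow .nat)), rel_map]
    exact h.mono fun a h => h.2
  · have h := hZ' i
    rw [mem_ext_iff]
    obtain ⟨w, rfl, rfl, rfl⟩ := exists_joint₃ z Z y
    rw [rel_map] at h hy ⊢
    exact h.mono₂ hy fun a h h' => h.1 h'

/-! ### The cuts `cℕ` and `c/ℕ` -/

variable (U) in
/-- Relations between a hyperinteger parameter and a hyperinteger. -/
abbrev NatRel (P : ℕ → ℕ → Prop) (d y : U.Star .nat) : Prop := U.Rel (ρ := .nat) (σ := .nat) P d y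

theorem exists_natJoint₂ (x y : U.Star .nat) : ∃ w : U.Star (.prod .nat .nat),
    U.map (σ := .prod .nat .nat) (τ := .nat) (fun p : ℕ × ℕ => p.1) w = x ∧
      U.map (σ := .prod .nat .nat) (τ := .nat) (fun p : ℕ × ℕ => p.2) w = y :=
  exists_joint₂ x y

theorem mem_divCut {d y : U.Star .nat} : y ∈ U.divCut (U.htwoPow d) ↔
    ∀ n, U.NatRel (fun d y => y * n < 2 ^ d) d y := by
  refine forall_congr' fun n => ?_
  obtain ⟨w, rfl, rfl⟩ := exists_natJoint₂ d y
  rw [hmul, htwoPow, hnat_eq_map n w, pair_map, map_map (τ := .prod .nat .nat), map_map (τ := .nat),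
    hlt_map, NatRel, rel_map]

theorem mem_mulCut {d y : U.Star .nat} : y ∈ U.mulCut (U.htwoPow d) ↔
    ∃ n, U.NatRel (fun d y => y < 2 ^ d * n) d y := by
  refine exists_congr fun n => ?_
  obtain ⟨w, rfl, rfl⟩ := exists_natJoint₂ d y
  rw [hmul, htwoPow, hnat_eq_map n w, map_map (τ := .nat), pair_map, map_map (τ := .prod .nat .nat),
    hlt_map, NatRel, rel_map]

variable (U) in
/-- `d` exceeds every standard natural number. -/
def IsInfinite (d : U.Star .nat) : Prop := ∀ n : ℕ, U.Holds (σ := .nat) d (fun d : ℕ => n < d)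

theorem isInfinite_of_htwoPow_ne {d : U.Star .nat} (h : ∀ n, U.htwoPow d ≠ U.hnat n) :
    U.IsInfinite d := by
  have hne : ∀ n : ℕ, ¬ U.Holds (σ := .nat) d (fun d : ℕ => d = n) := by
    intro n hn
    refine h (2 ^ n) ?_
    rw [htwoPow, hnat_eq_map _ d, ← holds_eq]
    exact hn.mono fun a (ha : a = n) => by rw [ha]
  intro n
  induction n with
  | zero => exact (holds_not.2 (hne 0)).mono fun (a : ℕ) ha => Nat.pos_of_ne_zero ha
  | succ n ih =>
    exact ih.mono₂ (holds_not.2 (hne (n + 1))) fun (a : ℕ) h1 h2 => lt_of_le_of_ne h1 (Ne.symm h2)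

/-! ### Small sets cannot receive `c/ℕ` -/

theorem mul_lt_two_pow_aux {K n m d : ℕ} (hm : m ≤ K) (hK : 2 * K < d)
    (hn : n * (2 * K * K) ≤ 2 ^ d) : (K * n + 1) * m < 2 ^ d := by
  have h3 : d < 2 ^ d := Nat.lt_two_pow_self
  have h4 : (K * n + 1) * m ≤ (K * n + 1) * K := Nat.mul_le_mul_left _ hm
  have h5 : 2 * ((K * n + 1) * K) = n * (2 * K * K) + 2 * K := by ring
  omega

theorem exists_lt_forall_notMem {H : Set (ℕ × ℕ)} {a n K : ℕ}
    (h : ∀ m ≤ K, {y | y < a ∧ (m, y) ∈ H}.ncard ≤ n) (ha : (K + 1) * n < a) :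
    ∃ x, x < a ∧ ∀ m ≤ K, (m, x) ∉ H := by
  by_contra! hno
  have h1 : (Finset.range a : Set ℕ) ⊆ ⋃ m ∈ Finset.range (K + 1), {y | y < a ∧ (m, y) ∈ H} := by
    intro x hx
    have hx : x < a := by simpa using hx
    obtain ⟨m, hm, hmx⟩ := hno x hx
    exact Set.mem_biUnion (Finset.mem_coe.2 (Finset.mem_range.2 (Nat.lt_succ_of_le hm))) ⟨hx, hmx⟩
  have h2 := Set.ncard_le_ncard h1 (Set.Finite.biUnion (Finset.finite_toSet _) fun m _ =>
    (Set.finite_lt_nat a).subset fun y hy => hy.1)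
  rw [Set.ncard_coe_finset, Finset.card_range] at h2
  have h3 := Finset.set_ncard_biUnion_le (Finset.range (K + 1)) fun m => {y | y < a ∧ (m, y) ∈ H}
  have h4 := Finset.sum_le_card_nsmul (Finset.range (K + 1))
    (fun m => {y | y < a ∧ (m, y) ∈ H}.ncard) n fun m hm => h m (by simpa [Nat.lt_succ_iff] using hm)
  simp only [Finset.card_range, smul_eq_mul] at h4
  omega

/-- Saturation gives a with m|Z| < a and am < 2^d for all standard m, so [0, a) lies in c/ℕ. An
internal partial injection into Z reaches at most |Z| points of [0, a), hence finitely many miss a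
point, and by saturation so do countably many. -/
theorem not_cdLe_divCut_of_isSmall {d : U.Star .nat} (hd : U.IsInfinite d) {Z : U.Star (.pow .nat)}
    (hZ : U.IsSmall d Z) : ¬ U.CDLe (U.divCut (U.htwoPow d)) (U.ext Z) := by
  rintro ⟨θ, hm, hi, hg⟩
  obtain ⟨ι, _, F, E, hF, hE, hFE, hcov⟩ := exists_internal_of_cdGraph hi hg
  -- an initial segment `[0, a)` of `c/ℕ` that is infinitely longer than `Z`
  let C : ℕ → ℕ × Set ℕ → ℕ → Prop := fun m p a => m * p.2.ncard < a ∧ a * m < 2 ^ p.1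
  obtain ⟨a, ha⟩ := exists_forall_mem (U := U) (A := fun m =>
      {a | U.Rel (ρ := .prod .nat (.pow .nat)) (σ := .nat) (C m) (U.pair d Z) a})
    (fun m => isInternal_rel (ρ := .prod .nat (.pow .nat)) (σ := .nat) (C m) _) (by
      intro K
      -- K|Z| + 1 is the least value meeting the lower bounds up to K; the upper bounds follow from
      -- |Z| · 2K² ≤ 2^d together with 2K < d.
      have hz := fun m => rel_map (U := U) (ρ := .prod .nat (.pow .nat)) (τ := .nat) (P := C m)
        (f := fun a => a) (g := fun p => K * p.2.ncard + 1) (w := U.pair d Z)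
      simp only [U.map_id] at hz
      refine ⟨_, fun m hmK => (hz m).2 ?_⟩
      have h1 : U.Holds (σ := .prod .nat (.pow .nat)) (U.pair d Z) (fun p => 2 * K < p.1) :=
        (holds_pair_fst (ρ := .nat) (P := fun n : ℕ => 2 * K < n)).2 (hd _)
      refine (hZ (2 * K * K)).mono₂ h1 fun p hp hK => ?_
      have h2 := hp.2
      constructor
      · exact Nat.lt_succ_of_le (Nat.mul_le_mul_right _ hmK)
      · exact mul_lt_two_pow_aux hmK hK h2)
  have ha' : ∀ m, U.Rel (ρ := .prod .nat (.pow .nat)) (σ := .nat) (C m) (U.pair d Z) a := ha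
  have hcut : ∀ y, U.NatRel (fun a y => y < a) a y → y ∈ U.divCut (U.htwoPow d) := by
    intro y hy
    rw [mem_divCut]
    intro n
    have h := ha' n
    obtain ⟨w, rfl, rfl, rfl, rfl⟩ := exists_joint₄ d Z a y
    rw [pair_map, rel_map] at h
    rw [NatRel, rel_map] at hy ⊢
    refine h.mono₂ hy fun p h (h' : p.2.2.2 < p.2.2.1) => ?_
    exact lt_of_le_of_lt (Nat.mul_le_mul_right n h'.le) h.2
  have hne : Nonempty ι := by
    have h0 : U.hnat 0 ∈ U.divCut (U.htwoPow d) := by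
      rw [mem_divCut]
      intro n
      rw [hnat_eq_map 0 d]
      have := rel_map (U := U) (ρ := .nat) (τ := .nat) (P := fun d y => y * n < 2 ^ d)
        (f := fun a => a) (g := fun _ => (0 : ℕ)) (w := d)
      rw [U.map_id] at this
      exact this.2 (holds_of_forall fun a => by simp)
    exact ⟨(hcov _ h0).choose⟩
  obtain ⟨e, he⟩ := exists_surjective_nat ι
  have hY : ∀ m, U.IsInternal (E (e m) ∩ F (e m) ⁻¹' U.ext Z) := fun m =>
    (hE _).inter (IsInternal.preimage ⟨Z, rfl⟩ (hF _))
  obtain ⟨H, hH⟩ := exists_code hY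
  -- the pieces have at most `|Z|` elements
  have hcount : ∀ m : ℕ, U.Rel (ρ := .pow (.prod .nat .nat)) (σ := .prod .nat (.pow .nat))
      (fun (H : Set (ℕ × ℕ)) (p : ℕ × Set ℕ) => {y | y < p.1 ∧ (m, y) ∈ H}.ncard ≤ p.2.ncard)
      H (U.pair a Z) := by
    intro m
    by_contra hcon
    obtain ⟨ζ, z, f, hf⟩ := hF (e m)
    have hfin := hZ 0
    have hx : ∀ x, U.Rel (ρ := .pow (.prod .nat .nat)) (σ := .nat)
        (fun (H : Set (ℕ × ℕ)) y => (m, y) ∈ H) H x →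
        x ∈ E (e m) ∧ U.Rel (ρ := .pow .nat) (fun Z y => y ∈ Z) Z (app f z x) := fun x h =>
      have h := (hH m x).2 h
      ⟨h.1, mem_ext_iff.1 (hf ▸ h.2)⟩
    have hinj := hFE (e m)
    rw [hf] at hinj
    clear_value C
    clear hH hcut ha ha' hd hi hg hm hcov hY hZ
    obtain ⟨w, rfl, rfl, rfl, rfl⟩ := exists_joint₄ H a Z d
    obtain ⟨v, rfl, rfl⟩ := exists_joint₂ z w
    simp only [map_map (τ := .prod (.pow (.prod .nat .nat)) (.prod .nat (.prod (.pow .nat) .nat)))]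
      at hcon hfin hx
    rw [pair_map, rel_map, ← holds_not] at hcon
    rw [rel_map] at hfin
    -- One existential covers both ways in which f could fail to inject the piece into Z: a pair (y,
    -- y) witnesses a value outside Z, a pair of distinct points a collision. The first is excluded
    -- by `hx`, the second by `hinj`.
    have hex : U.Holds v (fun q => ∃ r : ℕ × ℕ,
        ((r.1 < q.2.2.1 ∧ (m, r.1) ∈ q.2.1) ∧ (r.2 < q.2.2.1 ∧ (m, r.2) ∈ q.2.1)) ∧
          (f q.1 r.1 ∈ q.2.2.2.1 → r.1 ≠ r.2 ∧ f q.1 r.1 = f q.1 r.2)) := by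
      refine hcon.mono₂ hfin fun q hq hq' => ?_
      by_contra hno
      push Not at hno
      refine hq (Set.ncard_le_ncard_of_injOn (f q.1) ?_ ?_ hq'.1)
      · exact fun y hy => (hno (y, y) ⟨hy, hy⟩).1
      · intro y hy y' hy' h
        by_contra hne
        exact (hno (y, y') ⟨hy, hy'⟩).2 hne h
    obtain ⟨r, hr⟩ := (holds_exists (τ := .prod .nat .nat)).1 hex
    obtain ⟨t, rfl, rfl⟩ := exists_joint₂ v r
    simp only [map_map (τ := .prod ζ
      (.prod (.pow (.prod .nat .nat)) (.prod .nat (.prod (.pow .nat) .nat))))] at hx hinj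
    rw [pair_map, holds_map] at hr
    let Θ : StdType := .prod (.prod ζ
      (.prod (.pow (.prod .nat .nat)) (.prod .nat (.prod (.pow .nat) .nat)))) (.prod .nat .nat)
    have h1 := hx (U.map (σ := Θ) (τ := .nat) (fun q => q.2.1) t) (rel_map.2 (hr.mono fun q h => h.1.1.2))
    have h2 := hx (U.map (σ := Θ) (τ := .nat) (fun q => q.2.2) t) (rel_map.2 (hr.mono fun q h => h.1.2.2))
    have h3 := h1.2
    rw [app_map, rel_map] at h3
    have h4 := hr.mono₂ h3 fun q h h' => h.2 h'
    have h5 := hinj h1.1 h2.1 (by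
      rw [app_map, app_map, ← holds_eq]
      exact h4.mono fun q h => h.2)
    rw [← holds_eq] at h5
    exact holds_const.1 (h4.mono₂ h5 fun q h h' => h.1 h')
  obtain ⟨x, hx⟩ := exists_forall_mem (U := U)
    (A := fun m => {x | U.NatRel (fun a y => y < a) a x} ∩ (E (e m) ∩ F (e m) ⁻¹' U.ext Z)ᶜ)
    (fun m => (isInternal_rel (ρ := .nat) (σ := .nat) _ a).inter (hY m).compl) (by
      intro K
      have h1 := ha' (K + 1)
      have hcount' := fun m (_ : m ≤ K) => hcount m
      clear hcount hcut ha ha' hd hi hg hm hcov hY hZ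
      obtain ⟨w, rfl, rfl, rfl, rfl⟩ := exists_joint₄ H a Z d
      simp only [pair_map, rel_map] at hcount' h1
      have h2 := h1.mono₂ (holds_forall_le.2 hcount') fun q h h' => exists_lt_forall_notMem h' h.1
      obtain ⟨x, hx⟩ := (holds_exists (τ := .nat)).1 h2
      refine ⟨x, fun m hm => ?_⟩
      obtain ⟨v, rfl, rfl⟩ := exists_joint₂ w x
      rw [pair_map, holds_map] at hx
      simp only [map_map (τ := .prod (.pow (.prod .nat .nat)) (.prod .nat (.prod (.pow .nat) .nat)))]
        at hH ⊢
      constructor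
      · change U.NatRel (fun a y => y < a) _ _
        rw [NatRel, rel_map]
        exact hx.mono fun q h => h.1
      · change ¬ (U.map _ v ∈ E (e m) ∩ F (e m) ⁻¹' U.ext _)
        rw [hH, rel_map, ← holds_not]
        exact hx.mono fun q h => h.2 m hm)
  obtain ⟨i, hi1, hi2⟩ := hcov x (hcut x (hx 0).1)
  obtain ⟨m, rfl⟩ := he i
  refine (hx m).2 ⟨hi1, ?_⟩
  rw [Set.mem_preimage, ← hi2]
  exact hm (hcut x (hx 0).1)

/-! ### Leading binary digits -/

/-- The number with binary digits `g 0, …, g (k - 1)`, the most significant digit first. -/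
def prefixNum (g : ℕ → Fin 2) : ℕ → ℕ
  | 0 => 0
  | k + 1 => 2 * prefixNum g k + (g k : ℕ)

theorem prefixNum_congr {g h : ℕ → Fin 2} {k : ℕ} (e : ∀ i < k, g i = h i) :
    prefixNum g k = prefixNum h k := by
  induction k with
  | zero => rfl
  | succ k ih => rw [prefixNum, prefixNum, ih fun i hi => e i (by omega), e k (by omega)]

theorem div_two_pow_sub_div_two {d k y : ℕ} (h : k < d) :
    y / 2 ^ (d - (k + 1)) / 2 = y / 2 ^ (d - k) := by
  rw [Nat.div_div_eq_div_mul, ← pow_succ, show d - (k + 1) + 1 = d - k by omega]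

variable (U) in
open Classical in
/-- The standard part of the sequence of the binary digits of `y < 2 ^ d`. -/
noncomputable def leadingDigits (d y : U.Star .nat) (k : ℕ) : Fin 2 :=
  if U.NatRel (fun d y => y / 2 ^ (d - (k + 1)) % 2 = 1) d y then 1 else 0

variable (U) in
/-- The set of all `y < 2 ^ d` with leading binary digits `g`. -/
def digitMonad (d : U.Star .nat) (g : ℕ → Fin 2) : Set (U.Star .nat) :=
  {y | ∀ k, U.NatRel (fun d y => y / 2 ^ (d - k) = prefixNum g k) d y}

theorem natRel_fst {P : ℕ → Prop} {d y : U.Star .nat} (h : U.Holds (σ := .nat) d P) :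
    U.NatRel (fun d _ => P d) d y := holds_pair_fst.2 h

/-- Since d is infinite, every standard k is below d, the subtraction d - (k + 1) is not truncated,
and each longer prefix appends exactly one digit. The empty prefix encodes y < 2^d. -/
theorem mem_digitMonad_iff {d y : U.Star .nat} (hd : U.IsInfinite d) {g : ℕ → Fin 2} :
    y ∈ U.digitMonad d g ↔
      U.NatRel (fun d y => y < 2 ^ d) d y ∧ U.leadingDigits d y = g := by
  constructor
  · intro h
    refine ⟨(h 0).mono fun p hp => ?_, ?_⟩
    · have := Nat.div_eq_zero_iff.1 hp
      simpa using this
    · ext1 k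
      have h1 : U.NatRel (fun d y => y / 2 ^ (d - (k + 1)) % 2 = (g k : ℕ)) d y := by
        refine (h (k + 1)).mono fun p hp => ?_
        dsimp only at hp ⊢
        rw [hp, prefixNum, Nat.mul_add_mod]
        exact Nat.mod_eq_of_lt (g k).2
      unfold leadingDigits
      have h2 : g k = 0 ∨ g k = 1 := by omega
      rcases h2 with h2 | h2
      · rw [h2] at h1 ⊢
        rw [if_neg]
        intro h3
        refine holds_const.1 (h1.mono₂ h3 fun p (h4 : _ = ((0 : Fin 2) : ℕ)) h5 => ?_)
        rw [h5] at h4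
        exact absurd h4 (by decide)
      · rw [h2] at h1 ⊢
        rw [if_pos]
        exact h1
  · rintro ⟨hy, rfl⟩ k
    induction k with
    | zero => exact hy.mono fun p hp => Nat.div_eq_of_lt hp
    | succ k ih =>
      have hk : ∀ v, U.leadingDigits d y k = v →
          U.NatRel (fun d y => y / 2 ^ (d - (k + 1)) % 2 = (v : ℕ)) d y := by
        rintro v rfl
        by_cases h : U.NatRel (fun d y => y / 2 ^ (d - (k + 1)) % 2 = 1) d y
        · simp only [leadingDigits, if_pos h]
          exact h
        · simp only [leadingDigits, if_neg h]
          exact (holds_not.2 h).mono fun p hp => (Nat.mod_two_eq_zero_or_one _).resolve_right hp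
      refine ih.mono₃ (hk _ rfl) (natRel_fst (hd k)) fun p h1 h2 h3 => ?_
      rw [prefixNum, ← h1, ← h2, ← div_two_pow_sub_div_two h3]
      exact (Nat.div_add_mod _ 2).symm

theorem self_mem_digitMonad {d y : U.Star .nat} (hd : U.IsInfinite d)
    (hy : U.NatRel (fun d y => y < 2 ^ d) d y) : y ∈ U.digitMonad d (U.leadingDigits d y) :=
  (mem_digitMonad_iff hd).2 ⟨hy, rfl⟩

theorem isCD_leadingDigits_mem (d : U.Star .nat) (S : Set (ℕ → Fin 2)) :
    U.IsCD {y | U.leadingDigits d y ∈ S} := by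
  classical
  convert isCD_of_isInternal (U := U) (σ := .nat)
    (fun k => isInternal_rel (U := U) (ρ := .nat) (σ := .nat)
      (fun d y : ℕ => y / 2 ^ (d - (k + 1)) % 2 = 1) d)
    (fun K => (fun k => if k ∈ K then (1 : Fin 2) else 0) ∈ S) using 1
  ext y
  simp only [Set.mem_ofPred]
  refine iff_of_eq (congrArg (· ∈ S) ?_)
  ext1 k
  unfold leadingDigits
  congr

theorem isCD_digitMonad (d : U.Star .nat) (g : ℕ → Fin 2) : U.IsCD (U.digitMonad d g) :=
  isCD_of_isInternal (U := U) (σ := .nat)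
    (fun k => isInternal_rel (U := U) (ρ := .nat) (σ := .nat)
      (fun d y : ℕ => y / 2 ^ (d - k) = prefixNum g k) d) (fun K => ∀ k, k ∈ K)

theorem isCD_lt_two_pow (d : U.Star .nat) : U.IsCD {y | U.NatRel (fun d y => y < 2 ^ d) d y} :=
  (isInternal_rel (U := U) (ρ := .nat) (σ := .nat) (fun d y : ℕ => y < 2 ^ d) d).isCD

theorem natRel_lt_trichotomy (x y : U.Star .nat) :
    U.NatRel (· < ·) x y ∨ x = y ∨ U.NatRel (· < ·) y x := by
  obtain ⟨w, rfl, rfl⟩ := exists_natJoint₂ x y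
  rw [NatRel, NatRel, rel_map, rel_map, ← holds_eq, ← holds_or, ← holds_or]
  exact holds_of_forall fun a => lt_trichotomy _ _

theorem natRel_lt_of_mem_digitMonad {d y y' : U.Star .nat} {g g' : ℕ → Fin 2} {n : ℕ}
    (hy : y ∈ U.digitMonad d g) (hy' : y' ∈ U.digitMonad d g') (h : ∀ i < n, g i = g' i)
    (hn : g n < g' n) : U.NatRel (· < ·) y y' := by
  have h1 := hy (n + 1)
  have h2 := hy' (n + 1)
  obtain ⟨w, rfl, rfl, rfl⟩ := exists_joint₃ d y y'
  rw [NatRel, rel_map] at h1 h2 ⊢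
  refine h1.mono₂ h2 fun a e1 e2 => ?_
  rw [prefixNum, prefixNum_congr h] at e1
  rw [prefixNum] at e2
  have h3 : (g n : ℕ) < g' n := hn
  by_contra hle
  have := Nat.div_le_div_right (c := 2 ^ (a.1 - (n + 1))) (Nat.le_of_not_lt hle)
  omega

/-! ### Blocks of numbers with a given prefix -/

theorem setOf_div_eq (t n : ℕ) : {y | y / 2 ^ n = t} = Set.Ico (t * 2 ^ n) ((t + 1) * 2 ^ n) := by
  ext y
  rw [Set.mem_ofPred, Nat.div_eq_iff (by positivity), Set.mem_Ico]
  have : 0 < 2 ^ n := by positivity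
  rw [Nat.succ_mul, mul_comm]
  omega

theorem finite_setOf_div_eq (t n : ℕ) : {y | y / 2 ^ n = t}.Finite := by
  rw [setOf_div_eq]
  exact Set.finite_Ico _ _

theorem ncard_setOf_div_eq (t n : ℕ) : {y | y / 2 ^ n = t}.ncard = 2 ^ n := by
  rw [setOf_div_eq, ← Finset.coe_Ico, Set.ncard_coe_finset, Nat.card_Ico, Nat.succ_mul,
    Nat.add_sub_cancel_left]

/-! ### Sorting by signatures -/

open Classical in
/-- The sequence of truth values of `(m, i) ∈ H`, in the lexicographic order. -/
noncomputable def sigKey (H : Set (ℕ × ℕ)) (i : ℕ) : Lex (ℕ → Bool) :=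
  toLex fun m => decide ((m, i) ∈ H)

/-- The permutation of `[0, 2 ^ d)` that sorts by signatures, extended by the identity. -/
noncomputable def sortFun (p : ℕ × Set (ℕ × ℕ)) (i : ℕ) : ℕ :=
  if h : i < 2 ^ p.1 then (Tuple.sort (fun j : Fin (2 ^ p.1) => sigKey p.2 j) ⟨i, h⟩ : ℕ) else i

/-- The inverse of `sortFun`. -/
noncomputable def sortInv (p : ℕ × Set (ℕ × ℕ)) (i : ℕ) : ℕ :=
  if h : i < 2 ^ p.1 then ((Tuple.sort (fun j : Fin (2 ^ p.1) => sigKey p.2 j)).symm ⟨i, h⟩ : ℕ)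
  else i

theorem sortFun_lt {p : ℕ × Set (ℕ × ℕ)} {i : ℕ} (h : i < 2 ^ p.1) : sortFun p i < 2 ^ p.1 := by
  rw [sortFun, dif_pos h]
  exact Fin.is_lt _

theorem sortInv_lt {p : ℕ × Set (ℕ × ℕ)} {i : ℕ} (h : i < 2 ^ p.1) : sortInv p i < 2 ^ p.1 := by
  rw [sortInv, dif_pos h]
  exact Fin.is_lt _

theorem sortInv_sortFun (p : ℕ × Set (ℕ × ℕ)) (i : ℕ) : sortInv p (sortFun p i) = i := by
  by_cases h : i < 2 ^ p.1
  · rw [sortInv, dif_pos (sortFun_lt h)]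
    simp [sortFun, h]
  · simp [sortFun, sortInv, h]

theorem sortFun_sortInv (p : ℕ × Set (ℕ × ℕ)) (i : ℕ) : sortFun p (sortInv p i) = i := by
  by_cases h : i < 2 ^ p.1
  · rw [sortFun, dif_pos (sortInv_lt h)]
    simp [sortInv, h]
  · simp [sortFun, sortInv, h]

/-- A drop from true to false at the first difference would put the later key lexicographically
below the earlier one. -/
theorem sortFun_mono {p : ℕ × Set (ℕ × ℕ)} {i j m : ℕ} (hij : i < j) (hj : j < 2 ^ p.1)
    (hl : ∀ l < m, ((l, sortFun p i) ∈ p.2 ↔ (l, sortFun p j) ∈ p.2))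
    (hm : (m, sortFun p i) ∈ p.2) : (m, sortFun p j) ∈ p.2 := by
  by_contra hcon
  have h1 : sigKey p.2 (sortFun p i) ≤ sigKey p.2 (sortFun p j) := by
    have := Tuple.monotone_sort (fun j : Fin (2 ^ p.1) => sigKey p.2 j)
      (show (⟨i, hij.trans hj⟩ : Fin (2 ^ p.1)) ≤ ⟨j, hj⟩ from hij.le)
    rw [sortFun, dif_pos (hij.trans hj), sortFun, dif_pos hj]
    exact this
  have h2 : sigKey p.2 (sortFun p j) < sigKey p.2 (sortFun p i) := by
    refine ⟨m, fun l hlm => ?_, ?_⟩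
    · have := hl l hlm
      simp [sigKey, this]
    · simp [sigKey, hm, hcon]
  exact absurd h1 (not_le_of_gt h2)

/-! ### The dichotomy for sets with monotone signatures -/

variable (U) in
/-- The standard sequence of truth values of `*T m (z, y)`, `m ∈ ℕ`. -/
def signature (T : ℕ → ρ.El → ℕ → Prop) (z : U.Star ρ) (y : U.Star .nat) : Set ℕ :=
  {m | U.Rel (σ := .nat) (T m) z y}

/-- The set of all `y < 2 ^ δ a` whose first digits are those of `t` and whose first truth values
are those of `s`. -/
def block (T : ℕ → ρ.El → ℕ → Prop) (δ : ρ.El → ℕ) (k : ℕ) (s : Set ℕ) (t : ℕ) (a : ρ.El) : Set ℕ :=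
  {y | y < 2 ^ δ a ∧ y / 2 ^ (δ a - k) = t ∧ ∀ i < k, (T i a y ↔ i ∈ s)}

theorem finite_block (T : ℕ → ρ.El → ℕ → Prop) (δ : ρ.El → ℕ) (k : ℕ) (s : Set ℕ) (t : ℕ)
    (a : ρ.El) : (block T δ k s t a).Finite :=
  (Set.finite_lt_nat (2 ^ δ a)).subset fun _ hy => hy.1

theorem block_congr {T : ℕ → ρ.El → ℕ → Prop} {δ : ρ.El → ℕ} {k : ℕ} {s s' : Set ℕ} {t : ℕ}
    (h : ∀ i < k, (i ∈ s ↔ i ∈ s')) : block T δ k s t = block T δ k s' t := by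
  ext a y
  refine and_congr_right fun _ => and_congr_right fun _ => forall₂_congr fun i hi => ?_
  rw [h i hi]

variable (U) in
/-- The measure of the block is infinitesimal. -/
def IsSmallBlock (z : U.Star ρ) (T : ℕ → ρ.El → ℕ → Prop) (δ : ρ.El → ℕ) (k : ℕ) (s : Set ℕ)
    (t : ℕ) : Prop :=
  ∀ m : ℕ, U.Holds z fun a => (block T δ k s t a).ncard * m ≤ 2 ^ δ a

/-- All small blocks are contained in a small internal set. -/
theorem exists_isSmall_blocks {d : U.Star .nat} {z : U.Star ρ} {δ : ρ.El → ℕ}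
    (hd : U.map (τ := .nat) δ z = d) (T : ℕ → ρ.El → ℕ → Prop) :
    ∃ Z, U.IsSmall d Z ∧ ∀ k s t, U.IsSmallBlock z T δ k s t →
      ∀ y, U.Rel (σ := .nat) (fun a y => y ∈ block T δ k s t a) z y → y ∈ U.ext Z := by
  classical
  -- A block depends on s only through its part below k, so finite sets s suffice and there are
  -- countably many blocks.
  obtain ⟨e, he⟩ := exists_surjective_nat (ℕ × Finset ℕ × ℕ)
  let T' : ℕ → ρ.El → Set ℕ := fun n =>
    if U.IsSmallBlock z T δ (e n).1 (e n).2.1 (e n).2.2 then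
      block T δ (e n).1 (e n).2.1 (e n).2.2 else fun _ => ∅
  obtain ⟨Z, hZ, h⟩ := exists_isSmall_cover hd (T := T') (by
    intro i m
    by_cases hi : U.IsSmallBlock z T δ (e i).1 (e i).2.1 (e i).2.2
    · simp only [T', if_pos hi]
      exact (hi m).mono fun a ha => ⟨finite_block _ _ _ _ _ _, ha⟩
    · simp only [T', if_neg hi]
      exact holds_of_forall fun a => by simp)
  refine ⟨Z, hZ, fun k s t hs y hy => ?_⟩
  have hc : block T δ k s t = block T δ k ((Finset.range k).filter (· ∈ s) : Finset ℕ) t :=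
    block_congr fun i hi => by simp [hi]
  obtain ⟨n, hn⟩ := he (k, (Finset.range k).filter (· ∈ s), t)
  have hT : T' n = block T δ k s t := by
    rw [hc]
    simp only [T', hn]
    rw [if_pos]
    unfold IsSmallBlock at hs ⊢
    rwa [hc] at hs
  refine h n y ?_
  rw [hT]
  exact hy

theorem rel_param {P : ℕ → ℕ → Prop} {d y : U.Star .nat} {z : U.Star ρ} {δ : ρ.El → ℕ}
    (hd : U.map (τ := .nat) δ z = d) :
    U.Rel (σ := .nat) (fun a y => P (δ a) y) z y ↔ U.NatRel P d y := by
  subst hd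
  obtain ⟨w, rfl, rfl⟩ := exists_joint₂ z y
  rw [rel_map, NatRel, map_map, rel_map]

theorem rel_block {d y : U.Star .nat} {z : U.Star ρ} {δ : ρ.El → ℕ}
    (hd : U.map (τ := .nat) δ z = d) {T : ℕ → ρ.El → ℕ → Prop} {k : ℕ} {s : Set ℕ} {t : ℕ} :
    U.Rel (σ := .nat) (fun a y => y ∈ block T δ k s t a) z y ↔
      U.NatRel (fun d y => y < 2 ^ d) d y ∧ U.NatRel (fun d y => y / 2 ^ (d - k) = t) d y ∧
        ∀ i < k, (i ∈ U.signature T z y ↔ i ∈ s) := by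
  rw [← rel_param hd, ← rel_param hd]
  unfold signature Rel block
  simp only [Set.mem_ofPred, holds_and]
  refine and_congr_right fun _ => and_congr_right fun _ => ?_
  rw [holds_forall_lt (σ := .prod ρ .nat) (P := fun i p => (T i p.1 p.2 ↔ i ∈ s))]
  simp only [holds_iff, holds_const]

/-- `2 ^ (d - n)` numbers embed into a block that is not small, if `n` is large enough. -/
theorem exists_le_ncard_block {z : U.Star ρ} {T : ℕ → ρ.El → ℕ → Prop} {δ : ρ.El → ℕ} {k : ℕ}
    {s : Set ℕ} {t : ℕ} (hδ : ∀ n : ℕ, U.Holds z fun a => n < δ a)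
    (h : ¬ U.IsSmallBlock z T δ k s t) :
    ∃ n, U.Holds z fun a => 2 ^ (δ a - n) ≤ (block T δ k s t a).ncard := by
  simp only [IsSmallBlock, not_forall] at h
  obtain ⟨m, hm⟩ := h
  -- Non-smallness at m means |block| · m > 2^d, and m ≤ 2^m, so n = m works.
  refine ⟨m, (holds_not.2 hm).mono₂ (hδ m) fun a h1 h2 => ?_⟩
  have h3 : 2 ^ (δ a - m) * 2 ^ m = 2 ^ δ a := by rw [← pow_add, Nat.sub_add_cancel h2.le]
  have h4 : m ≤ 2 ^ m := Nat.lt_two_pow_self.le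
  by_contra hlt
  push Not at hlt
  refine h1 ?_
  calc (block T δ k s t a).ncard * m ≤ 2 ^ (δ a - m) * 2 ^ m := Nat.mul_le_mul hlt.le h4
    _ = 2 ^ δ a := h3

theorem div_two_pow_sub_eq_prefixNum {d k y : ℕ} {g : ℕ → Fin 2} (hk : k < d)
    (h : y / 2 ^ (d - (k + 1)) = prefixNum g (k + 1)) : y / 2 ^ (d - k) = prefixNum g k := by
  rw [← div_two_pow_sub_div_two hk, h, prefixNum]
  omega

/-- A monad embeds internally into an intersection of blocks that are not small. -/
theorem exists_internal_into_blocks {d : U.Star .nat} {z : U.Star ρ} {δ : ρ.El → ℕ}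
    (hd : U.map (τ := .nat) δ z = d) (hinf : U.IsInfinite d) {T : ℕ → ρ.El → ℕ → Prop} {b : Set ℕ}
    {g : ℕ → Fin 2} (hb : ∀ k, ¬ U.IsSmallBlock z T δ k b (prefixNum g k)) :
    ∃ F : U.Star .nat → U.Star .nat, InternalFun F ∧ Set.InjOn F (U.digitMonad d g) ∧
      ∀ y ∈ U.digitMonad d g, F y ∈ U.digitMonad d g ∧ U.signature T z (F y) = b := by
  have hδ : ∀ n : ℕ, U.Holds z fun a => n < δ a := by
    intro n
    have := hinf n
    rw [← hd, holds_map] at this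
    exact this
  choose n hn using fun k => exists_le_ncard_block hδ (hb k)
  -- V k has at most 2^(d - n k) points and W k at least as many. Imposing all j ≤ k makes the V k
  -- decreasing whatever n is. Every V k contains the monad, and the W k intersect in the part of
  -- the monad with signature b.
  obtain ⟨F, hF, hi, hm⟩ := exists_internal_injOn_chain (z := z)
    (V := fun k a => {y | ∀ j ≤ k, y / 2 ^ (δ a - n j) = prefixNum g (n j)})
    (W := fun k a => block T δ k b (prefixNum g k) a)
    (holds_of_forall fun a => ⟨(finite_setOf_div_eq (prefixNum g (n 0)) (δ a - n 0)).subset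
      fun y hy => hy 0 le_rfl, finite_block _ _ _ _ _ _⟩)
    (fun k => holds_of_forall fun a y hy j hj => hy j (by omega))
    (fun k => (hδ k).mono fun a ha y hy =>
      ⟨hy.1, div_two_pow_sub_eq_prefixNum ha hy.2.1, fun i hi => hy.2.2 i (by omega)⟩)
    (fun k => (hn k).mono fun a ha => by
      refine le_trans ?_ ha
      rw [← ncard_setOf_div_eq (prefixNum g (n k))]
      exact Set.ncard_le_ncard (fun y hy => hy k le_rfl) (finite_setOf_div_eq _ _))
  have hV : ∀ y ∈ U.digitMonad d g, ∀ k, U.Rel (σ := .nat)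
      (fun a y => y ∈ {y | ∀ j ≤ k, y / 2 ^ (δ a - n j) = prefixNum g (n j)}) z y := by
    intro y hy k
    refine (holds_forall_le (σ := .prod ρ .nat) (P := fun j p => p.2 / 2 ^ (δ p.1 - n j) = prefixNum g (n j))).2
      fun j _ => ?_
    exact (rel_param (P := fun d y => y / 2 ^ (d - n j) = prefixNum g (n j)) hd).2 (hy (n j))
  refine ⟨F, hF, hi.mono fun y hy => hV y hy 0, fun y hy => ⟨fun k => ?_, ?_⟩⟩
  · exact ((rel_block hd).1 (hm k y (hV y hy k))).2.1
  · ext i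
    exact ((rel_block hd).1 (hm (i + 1) y (hV y hy _))).2.2 i (by omega)

variable (U) in
/-- The set of all `y < 2 ^ d` whose leading binary digits belong to `G`. -/
def digitMonadUnion (d : U.Star .nat) (G : Set (ℕ → Fin 2)) : Set (U.Star .nat) :=
  {y | U.NatRel (fun d y => y < 2 ^ d) d y ∧ U.leadingDigits d y ∈ G}

theorem isCD_digitMonadUnion (d : U.Star .nat) (G : Set (ℕ → Fin 2)) :
    U.IsCD (U.digitMonadUnion d G) :=
  (isCD_lt_two_pow d).inter (isCD_leadingDigits_mem d G)

/-- A small internal set is absorbed by a monad. -/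
theorem exists_internal_absorb {d : U.Star .nat} (hinf : U.IsInfinite d) {Z : U.Star (.pow .nat)}
    (hZ : U.IsSmall d Z) (g : ℕ → Fin 2) :
    ∃ F : U.Star .nat → U.Star .nat, InternalFun F ∧ Set.InjOn F (U.ext Z ∪ U.digitMonad d g) ∧
      Set.MapsTo F (U.ext Z ∪ U.digitMonad d g) (U.digitMonad d g) := by
  have hδ : ∀ n : ℕ, U.Holds (σ := .prod .nat (.pow .nat)) (U.pair d Z) fun a => n < a.1 :=
    fun n => (holds_pair_fst (ρ := .nat) (P := fun d : ℕ => n < d)).2 (hinf n)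
  -- The prefix is one digit longer in V k than in W k: it fills only half of W k, and the other
  -- half has room for Z.
  obtain ⟨F, hF, hi, hm⟩ := exists_internal_injOn_chain (ρ := .prod .nat (.pow .nat))
    (z := U.pair d Z)
    (V := fun k a => a.2 ∪ {y | y / 2 ^ (a.1 - (k + 1)) = prefixNum g (k + 1)})
    (W := fun k a => {y | y / 2 ^ (a.1 - k) = prefixNum g k})
    ((hZ 0).mono fun a ha => ⟨ha.1.union (finite_setOf_div_eq _ _), finite_setOf_div_eq _ _⟩)
    (fun k => (hδ (k + 1)).mono fun a ha => Set.union_subset_union_right _ fun y hy =>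
      div_two_pow_sub_eq_prefixNum ha hy)
    (fun k => (hδ k).mono fun a ha y hy => div_two_pow_sub_eq_prefixNum ha hy)
    (fun k => (hδ k).mono₂ (hZ (2 ^ (k + 1))) fun a ha hz => by
      rw [ncard_setOf_div_eq]
      refine (Set.ncard_union_le _ _).trans ?_
      have h0 : ∀ m n : ℕ, n < m → m - n = m - (n + 1) + 1 := by omega
      rw [ncard_setOf_div_eq, h0 _ _ ha, pow_succ, mul_two]
      have h1 := hz.2
      have h2 : 2 ^ (a.1 - (k + 1)) * 2 ^ (k + 1) = 2 ^ a.1 := by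
        rw [← pow_add, Nat.sub_add_cancel ha]
      refine Nat.add_le_add_right (Nat.le_of_mul_le_mul_right ?_ (Nat.two_pow_pos (k + 1))) _
      rw [h2]
      exact h1)
  have hV : ∀ y ∈ U.ext Z ∪ U.digitMonad d g, ∀ k, U.Rel (ρ := .prod .nat (.pow .nat)) (σ := .nat)
      (fun a y => y ∈ a.2 ∪ {y | y / 2 ^ (a.1 - (k + 1)) = prefixNum g (k + 1)}) (U.pair d Z) y := by
    rintro y (hy | hy) k
    · rw [mem_ext_iff] at hy
      refine ((rel_snd_param (P := fun Z y => y ∈ Z) (z := d)).2 hy).mono fun p hp => Or.inl hp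
    · have h1 : U.NatRel (fun d y => y / 2 ^ (d - (k + 1)) = prefixNum g (k + 1)) d y := hy (k + 1)
      have h2 := (rel_fst_param (z' := Z)).2 h1
      exact h2.mono fun p hp => Or.inr hp
  refine ⟨F, hF, hi.mono fun y hy => hV y hy 0, fun y hy k => ?_⟩
  exact (rel_fst_param (z' := Z)).1 (hm k y (hV y hy k))

/-- Monotonicity `hT` serves only to show that countably many monads carry two signatures. Otherwise
the injections chosen for the various g in G could be uncountably many different internal maps, and
gluing them need not give a CD map. -/
theorem cdLe_or_of_monotone_signature {d : U.Star .nat} (hinf : U.IsInfinite d) {z : U.Star ρ}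
    {δ : ρ.El → ℕ} (hd : U.map (τ := .nat) δ z = d) {T : ℕ → ρ.El → ℕ → Prop}
    (hT : ∀ a i j m, i < j → j < 2 ^ δ a → (∀ l < m, (T l a i ↔ T l a j)) → T m a i → T m a j)
    (B : Set (Set ℕ)) {X : Set (U.Star .nat)}
    (hX : X = {y | U.NatRel (fun d y => y < 2 ^ d) d y ∧ U.signature T z y ∈ B}) :
    (∃ Z, U.IsSmall d Z ∧ X ⊆ U.ext Z) ∨
      ∃ G, U.CDLe X (U.digitMonadUnion d G) ∧ U.CDLe (U.digitMonadUnion d G) X := by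
  classical
  obtain ⟨Z, hZ, hZb⟩ := exists_isSmall_blocks hd T
  have hXCD : U.IsCD X := by
    rw [hX]
    exact (isCD_lt_two_pow d).inter (isCD_of_isInternal
      (fun m => isInternal_rel (σ := .nat) (T m) z) (fun S => S ∈ B))
  -- The signature b may vary with g; it is the target signature for `exists_internal_into_blocks`.
  let G : Set (ℕ → Fin 2) := {g | ∃ b ∈ B, ∀ k, ¬ U.IsSmallBlock z T δ k b (prefixNum g k)}
  have hXG : ∀ y ∈ X, y ∉ U.ext Z → U.leadingDigits d y ∈ G := by
    intro y hy hyZ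
    rw [hX] at hy
    refine ⟨_, hy.2, fun k hk => hyZ (hZb k _ _ hk y ((rel_block hd).2 ⟨hy.1, ?_, fun i _ => Iff.rfl⟩))⟩
    exact self_mem_digitMonad hinf hy.1 k
  rcases G.eq_empty_or_nonempty with hG | ⟨g₀, hg₀⟩
  · refine Or.inl ⟨Z, hZ, fun y hy => ?_⟩
    by_contra hyZ
    exact Set.notMem_empty _ (hG ▸ hXG y hy hyZ)
  refine Or.inr ⟨G, ?_, ?_⟩
  · obtain ⟨F, hF, hi, hm⟩ := exists_internal_absorb hinf hZ g₀
    let E := U.ext Z ∪ U.digitMonad d g₀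
    have hE : U.IsCD E := by
      have := ((IsInternal.isCD (U := U) ⟨Z, rfl⟩).compl.inter (isCD_digitMonad d g₀).compl).compl
      rwa [Set.compl_inter, compl_compl, compl_compl] at this
    have hout : ∀ y ∈ X, y ∉ E → y ∈ U.digitMonadUnion d G := fun y hy hyE =>
      ⟨(Set.ext_iff.1 hX y).1 hy |>.1, hXG y hy fun h => hyE (Or.inl h)⟩
    -- Only Z and the monad g₀ are moved, jointly into that monad. Images of moved points stay in E,
    -- so they never meet the fixed points outside E.
    refine CDMap.cdLe (θ := fun y => if y ∈ E then F y else y) ?_ hXCD ?_ ?_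
    · refine cdMap_of_countable (ι := Bool) (F := fun i => if i then F else fun y => y)
        (D := fun i => if i then E else Eᶜ) ?_ ?_ ?_ ?_
      · rintro (_ | _)
        exacts [internalFun_id, hF]
      · rintro (_ | _)
        exacts [hE.compl, hE]
      · intro x _
        by_cases hx : x ∈ E
        exacts [⟨true, hx⟩, ⟨false, hx⟩]
      · rintro (_ | _) x hx _
        · exact if_neg hx
        · exact if_pos hx
    · intro y hy
      by_cases hyE : y ∈ E
      · simp only [if_pos hyE]
        obtain ⟨h1, h2⟩ := (mem_digitMonad_iff hinf).1 (hm hyE)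
        exact ⟨h1, h2 ▸ hg₀⟩
      · simp only [if_neg hyE]
        exact hout y hy hyE
    · intro y hy y' hy' e
      by_cases h : y ∈ E <;> by_cases h' : y' ∈ E
      · simp only [if_pos h, if_pos h'] at e
        exact hi h h' e
      · simp only [if_pos h, if_neg h'] at e
        exact absurd (Or.inr (e ▸ hm h)) h'
      · simp only [if_neg h, if_pos h'] at e
        exact absurd (Or.inr (e.symm ▸ hm h')) h
      · simpa only [if_neg h, if_neg h'] using e
  · have hmono : ∀ y y', U.NatRel (· < ·) y y' → U.NatRel (fun d y => y < 2 ^ d) d y' → ∀ m,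
        (∀ l < m, (l ∈ U.signature T z y ↔ l ∈ U.signature T z y')) → m ∈ U.signature T z y →
        m ∈ U.signature T z y' := by
      intro y y' hyy' hy' m hl hm
      rw [← rel_param hd] at hy'
      change U.Rel (σ := .nat) (T m) z y at hm
      change U.Rel (σ := .nat) (T m) z y'
      change ∀ l < m, (U.Rel (σ := .nat) (T l) z y ↔ U.Rel (σ := .nat) (T l) z y') at hl
      clear hX hXG hXCD hZb hg₀
      clear_value G
      clear hd
      obtain ⟨w, rfl, rfl, rfl⟩ := exists_joint₃ z y y'
      simp only [NatRel, rel_map, ← holds_iff] at hyy' hy' hm hl ⊢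
      rw [← holds_forall_lt (σ := .prod ρ (.prod .nat .nat)) (P := fun l a => (T l a.1 a.2.1 ↔ T l a.1 a.2.2))] at hl
      exact (holds_and.2 ⟨hyy', hy'⟩).mono₃ hl hm fun a h1 h2 h3 => hT _ _ _ _ h1.1 h1.2 h2 h3
    have hF : ∀ g ∈ G, ∃ F : U.Star .nat → U.Star .nat, InternalFun F ∧
        Set.InjOn F (U.digitMonad d g) ∧
        ∀ y ∈ U.digitMonad d g, F y ∈ U.digitMonad d g ∧ U.signature T z (F y) ∈ B := by
      rintro g ⟨b, hb, hbg⟩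
      obtain ⟨F, hF, hi, hm⟩ := exists_internal_into_blocks hd hinf hbg
      exact ⟨F, hF, hi, fun y hy => ⟨(hm y hy).1, (hm y hy).2.symm ▸ hb⟩⟩
    have : Nonempty (U.Star .nat → U.Star .nat) := ⟨fun y => y⟩
    choose! F hF hi hm using hF
    -- On a monad from G outside N the signature is constant and equals that of F g y, which lies in
    -- B; such a monad is already contained in X.
    let N : Set (ℕ → Fin 2) := {g | g ∈ G ∧ ∃ y ∈ U.digitMonad d g, ∃ y' ∈ U.digitMonad d g,
      U.signature T z y ≠ U.signature T z y'}
    have hN : Countable N := by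
      -- a monad with two signatures is determined by their first difference
      have hlt : ∀ g : N, ∃ p : ℕ × Finset ℕ, ∃ y ∈ U.digitMonad d g, ∃ y' ∈ U.digitMonad d g,
          (∀ l < p.1, (l ∈ U.signature T z y ↔ l ∈ p.2)) ∧
          (∀ l < p.1, (l ∈ U.signature T z y' ↔ l ∈ p.2)) ∧
          p.1 ∉ U.signature T z y ∧ p.1 ∈ U.signature T z y' := by
        rintro ⟨g, -, y₁, hy₁, y₂, hy₂, hne⟩
        obtain ⟨y, hy, y', hy', hlt, hne⟩ : ∃ y ∈ U.digitMonad d g, ∃ y' ∈ U.digitMonad d g,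
            U.NatRel (· < ·) y y' ∧ U.signature T z y ≠ U.signature T z y' := by
          rcases natRel_lt_trichotomy y₁ y₂ with h | rfl | h
          exacts [⟨_, hy₁, _, hy₂, h, hne⟩, absurd rfl hne, ⟨_, hy₂, _, hy₁, h, hne.symm⟩]
        have hex : ∃ m, ¬ (m ∈ U.signature T z y ↔ m ∈ U.signature T z y') := by
          by_contra! h
          exact hne (Set.ext h)
        have hl : ∀ l < Nat.find hex, (l ∈ U.signature T z y ↔ l ∈ U.signature T z y') :=
          fun l hl => not_not.1 (Nat.find_min hex hl)
        have h1 := Nat.find_spec hex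
        have h2 := hmono y y' hlt ((mem_digitMonad_iff hinf).1 hy').1 _ hl
        refine ⟨(Nat.find hex, (Finset.range (Nat.find hex)).filter (· ∈ U.signature T z y)),
          y, hy, y', hy', ?_, ?_, by tauto, by tauto⟩
        · intro l hlt
          simp only [Finset.mem_filter, Finset.mem_range] at hlt ⊢
          tauto
        · intro l hlt
          have := hl l hlt
          simp only [Finset.mem_filter, Finset.mem_range] at hlt ⊢
          tauto
      choose f hf using hlt
      refine Function.Injective.countable (f := f) fun g g' hgg' => ?_
      -- two different monads are comparable
      have hkey : ∀ g g' : N, f g = f g' → ∀ n, (∀ i < n, g.1 i = g'.1 i) → ¬ g.1 n < g'.1 n := by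
        intro g g' e n hin hn
        obtain ⟨-, -, y', hy', -, h1, -, h2⟩ := hf g
        obtain ⟨y, hy, -, -, h3, -, h4, -⟩ := hf g'
        rw [e] at h1 h2
        -- The point y' of the lower monad has the truth value at index p.1 that y in the upper
        -- monad lacks, with equal values before it, against monotonicity.
        exact h4 (hmono y' y (natRel_lt_of_mem_digitMonad hy' hy hin hn)
          ((mem_digitMonad_iff hinf).1 hy).1 _ (fun l hl => (h1 l hl).trans (h3 l hl).symm) h2)
      by_contra hne
      have hex : ∃ n, g.1 n ≠ g'.1 n := by
        by_contra! h
        exact hne (Subtype.ext (funext h))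
      have hmin : ∀ i < Nat.find hex, g.1 i = g'.1 i := fun i hi => not_not.1 (Nat.find_min hex hi)
      rcases lt_or_gt_of_ne (Nat.find_spec hex) with h | h
      · exact hkey g g' hgg' _ hmin h
      · exact hkey g' g hgg'.symm _ (fun i hi => (hmin i hi).symm) h
    let θ : U.Star .nat → U.Star .nat := fun y =>
      if U.leadingDigits d y ∈ N then F (U.leadingDigits d y) y else y
    have hθ : ∀ y ∈ U.digitMonadUnion d G, θ y ∈ U.digitMonad d (U.leadingDigits d y) := by
      intro y hy
      have hself := self_mem_digitMonad hinf hy.1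
      by_cases h : U.leadingDigits d y ∈ N
      · simp only [θ, if_pos h]
        exact (hm _ h.1 y hself).1
      · simpa only [θ, if_neg h] using hself
    refine CDMap.cdLe (θ := θ) ?_ (isCD_digitMonadUnion d G) ?_ ?_
    · refine cdMap_of_countable (ι := Option N) (F := fun i => i.elim (fun y => y) fun g => F g)
        (D := fun i => i.elim {y | U.leadingDigits d y ∈ Nᶜ} fun g => {y | U.leadingDigits d y ∈ ({g.1} : Set _)})
        ?_ ?_ ?_ ?_
      · rintro (_ | g)
        exacts [internalFun_id, hF _ g.2.1]
      · rintro (_ | g)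
        exacts [isCD_leadingDigits_mem d _, isCD_leadingDigits_mem d _]
      · intro y _
        by_cases h : U.leadingDigits d y ∈ N
        exacts [⟨some ⟨_, h⟩, rfl⟩, ⟨none, h⟩]
      · rintro (_ | g) y hy _
        · exact if_neg hy
        · have hy : U.leadingDigits d y = g := hy
          have h : U.leadingDigits d y ∈ N := hy ▸ g.2
          simp only [θ, if_pos h, Option.elim, hy]
    · intro y hy
      rw [hX]
      refine ⟨((mem_digitMonad_iff hinf).1 (hθ y hy)).1, ?_⟩
      have hself := self_mem_digitMonad hinf hy.1
      have hFy := hm _ hy.2 y hself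
      by_cases h : U.leadingDigits d y ∈ N
      · simp only [θ, if_pos h]
        exact hFy.2
      · simp only [θ, if_neg h]
        have : U.signature T z y = U.signature T z (F (U.leadingDigits d y) y) := by
          by_contra hne
          exact h ⟨hy.2, y, hself, _, hFy.1, hne⟩
        rw [this]
        exact hFy.2
    · intro y hy y' hy' e
      have h1 := ((mem_digitMonad_iff hinf).1 (hθ y hy)).2
      have h2 := ((mem_digitMonad_iff hinf).1 (hθ y' hy')).2
      rw [e, h2] at h1
      by_cases h : U.leadingDigits d y ∈ N
      · have h' : U.leadingDigits d y' ∈ N := h1 ▸ h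
        simp only [θ, if_pos h, if_pos h', h1] at e
        exact hi _ h.1 (self_mem_digitMonad hinf hy.1)
          (h1 ▸ self_mem_digitMonad hinf hy'.1) e
      · have h' : U.leadingDigits d y' ∉ N := h1 ▸ h
        simpa only [θ, if_neg h, if_neg h'] using e

/-! ### Sorting -/

/-- Coding all A m in one internal H makes the sorting permutation F internal with parameters d and
H. X is replaced by its preimage under F, whose signature at y is that of X at F y. The sorting keys
also run over nonstandard indices, but their lexicographic order restricts to the standard ones. -/
theorem exists_sorted {d : U.Star .nat} {X : Set (U.Star .nat)} (hX : U.IsCD X)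
    (hXd : ∀ y ∈ X, U.NatRel (fun d y => y < 2 ^ d) d y) :
    ∃ (H : U.Star (.pow (.prod .nat .nat))) (B : Set (Set ℕ)) (X' : Set (U.Star .nat)),
      X' = {y | U.NatRel (fun d y => y < 2 ^ d) d y ∧
        U.signature (ρ := .prod .nat (.pow (.prod .nat .nat)))
          (fun m p y => (m, sortFun p y) ∈ p.2) (U.pair d H) y ∈ B} ∧
      U.CDLe X X' ∧ U.CDLe X' X := by
  obtain ⟨A, B, hA, hXA⟩ := isCD_iff.1 hX
  obtain ⟨H, hH⟩ := exists_code hA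
  let Ρ : StdType := .prod .nat (.pow (.prod .nat .nat))
  let z : U.Star Ρ := U.pair d H
  let F : U.Star .nat → U.Star .nat := app (ρ := Ρ) (σ := .nat) (τ := .nat) sortFun z
  let F' : U.Star .nat → U.Star .nat := app (ρ := Ρ) (σ := .nat) (τ := .nat) sortInv z
  have hz : U.map (σ := Ρ) (τ := .nat) (fun p => p.1) z = d := map_fst d H
  have hF : InternalFun F := internalFun_app _ _
  have hF' : InternalFun F' := internalFun_app _ _
  have hid : ∀ x, app (ρ := Ρ) (σ := .nat) (τ := .nat) (fun _ y => y) z x = x := fun x => map_snd z x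
  have hFF' : ∀ x, F (F' x) = x := by
    intro x
    rw [← hid x]
    simp only [F, F', app_app]
    rw [app_eq_app]
    exact holds_of_forall fun p => sortFun_sortInv p.1 p.2
  have hF'F : ∀ x, F' (F x) = x := by
    intro x
    rw [← hid x]
    simp only [F, F', app_app]
    rw [app_eq_app]
    exact holds_of_forall fun p => sortInv_sortFun p.1 p.2
  have hlt' : ∀ x, U.NatRel (fun d y => y < 2 ^ d) d x → U.NatRel (fun d y => y < 2 ^ d) d (F' x) := by
    intro x hx
    rw [← rel_param hz] at hx ⊢
    rw [rel_app]
    exact hx.mono fun p hp => sortInv_lt hp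
  let X' : Set (U.Star .nat) := {y | U.NatRel (fun d y => y < 2 ^ d) d y ∧
    U.signature (ρ := Ρ) (fun m p y => (m, sortFun p y) ∈ p.2) z y ∈ B}
  have hsig : ∀ y, U.signature (ρ := Ρ) (fun m p y => (m, sortFun p y) ∈ p.2) z y =
      {m | F y ∈ A m} := by
    intro y
    ext m
    change U.Rel (ρ := Ρ) (σ := .nat) (fun p y => (m, sortFun p y) ∈ p.2) z y ↔ F y ∈ A m
    rw [hH, ← rel_snd_param (ρ := .nat) (τ := .pow (.prod .nat .nat)) (σ := .nat) (z := d)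
      (P := fun (H : Set (ℕ × ℕ)) (y : ℕ) => (m, y) ∈ H), rel_app]
  have hmem : ∀ y, y ∈ X' ↔ U.NatRel (fun d y => y < 2 ^ d) d y ∧ F y ∈ X := by
    intro y
    change _ ∧ _ ↔ _
    rw [hsig, hXA]
    rfl
  refine ⟨H, B, X', rfl, (hF'.cdMap X).cdLe hX ?_ ?_, (hF.cdMap X').cdLe ?_ ?_ ?_⟩
  · intro x hx
    rw [hmem, hFF']
    exact ⟨hlt' x (hXd x hx), hx⟩
  · intro x _ y _ e
    rw [← hFF' x, e, hFF']
  · exact (isCD_lt_two_pow d).inter (isCD_of_isInternal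
      (fun m => isInternal_rel (ρ := Ρ) (σ := .nat) (fun p y => (m, sortFun p y) ∈ p.2) z)
      (fun S => S ∈ B))
  · exact fun y hy => ((hmem y).1 hy).2
  · intro x _ y _ e
    rw [← hF'F x, e, hF'F]

/-! ### A paradoxical decomposition of the Cantor space -/

/-- Equality of binary sequences up to finitely many terms. -/
def tailSetoid : Setoid (ℕ → Fin 2) where
  r g h := ∃ k, ∀ i, k ≤ i → g i = h i
  iseqv :=
    { refl := fun _ => ⟨0, fun _ _ => rfl⟩
      symm := fun ⟨k, hk⟩ => ⟨k, fun i hi => (hk i hi).symm⟩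
      trans := fun ⟨k, hk⟩ ⟨l, hl⟩ => ⟨max k l, fun i hi =>
        (hk i (le_of_max_le_left hi)).trans (hl i (le_of_max_le_right hi))⟩ }

theorem tail_class_countable (g : ℕ → Fin 2) :
    {h : ℕ → Fin 2 | ∃ k, ∀ i, k ≤ i → h i = g i}.Countable := by
  rw [Set.ofPred_exists]
  refine Set.countable_iUnion fun k => ?_
  have hinj : Function.Injective
      (fun (h : {h : ℕ → Fin 2 // ∀ i, k ≤ i → h i = g i}) (i : Fin k) => h.1 i) := by
    intro h h' e
    ext1
    ext1 i
    by_cases hi : i < k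
    · exact congrFun e ⟨i, hi⟩
    · rw [h.2 i (by omega), h'.2 i (by omega)]
  exact Set.countable_coe_iff.1 hinj.countable

theorem tail_class_infinite (g : ℕ → Fin 2) :
    {h : ℕ → Fin 2 | ∃ k, ∀ i, k ≤ i → h i = g i}.Infinite := by
  refine Set.infinite_of_injective_forall_mem (f := fun n => Function.update g n (g n + 1)) ?_ ?_
  · intro n m e
    by_contra hne
    have := congrFun e n
    simp [hne] at this
  · exact fun n => ⟨n + 1, fun i hi => Function.update_of_ne (by omega) _ _⟩

/-- Each class C modulo finite changes is countably infinite, hence C × ℕ ≃ C; such bijections are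
chosen class by class and glued. -/
theorem exists_paradoxical_equiv : ∃ φ : (ℕ → Fin 2) × ℕ ≃ (ℕ → Fin 2),
    ∀ g n, ∃ k, ∀ i, k ≤ i → φ (g, n) i = g i := by
  let mk : (ℕ → Fin 2) → Quotient tailSetoid := Quotient.mk tailSetoid
  have hclass : ∀ g, {h | mk h = mk g} = {h : ℕ → Fin 2 | ∃ k, ∀ i, k ≤ i → h i = g i} := by
    intro g
    ext h
    exact Quotient.eq (r := tailSetoid)
  have he : ∀ q, Nonempty ({h // mk h = q} × ℕ ≃ {h // mk h = q}) := by
    intro q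
    obtain ⟨g, rfl⟩ := Quotient.exists_rep q
    have h1 : Countable {h // mk h = mk g} := by
      have := (tail_class_countable g).to_subtype
      rwa [← hclass] at this
    have h2 : Infinite {h // mk h = mk g} := by
      have := (tail_class_infinite g).to_subtype
      rwa [← hclass] at this
    exact nonempty_equiv_of_countable
  let e := fun q => Classical.choice (he q)
  let s := Equiv.sigmaFiberEquiv mk
  let φ : (ℕ → Fin 2) × ℕ ≃ (ℕ → Fin 2) :=
    (Equiv.prodCongr s.symm (Equiv.refl ℕ)).trans ((Equiv.sigmaProdDistrib _ ℕ).trans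
      ((Equiv.sigmaCongrRight e).trans s))
  refine ⟨φ, fun g n => ?_⟩
  have h1 : mk (φ (g, n)) = mk g := (e (mk g) (⟨g, rfl⟩, n)).2
  exact Quotient.exact h1

/-! ### Reduction of `cℕ` to `[0, c)` -/

/-- Replacement of the prefix `s` of length `k` by the prefix `t`. -/
def prefixShift (k s t d y : ℕ) : ℕ := y + t * 2 ^ (d - k) - s * 2 ^ (d - k)

/-- Digits from position k on contribute equally to both numbers, which thus differ only by their
prefixes, scaled by 2^(J - k). -/
theorem prefixNum_add_eq {g h : ℕ → Fin 2} {k J : ℕ} (hk : k ≤ J)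
    (e : ∀ i, k ≤ i → h i = g i) :
    prefixNum h J + prefixNum g k * 2 ^ (J - k) = prefixNum g J + prefixNum h k * 2 ^ (J - k) := by
  induction J, hk using Nat.le_induction with
  | base => simp [add_comm]
  | succ J hJ ih =>
    rw [prefixNum, prefixNum, e J hJ, show J + 1 - k = J - k + 1 by omega, pow_succ]
    linarith

theorem div_eq_prefixNum_of_le {d j J y : ℕ} {g : ℕ → Fin 2} (hj : j ≤ J) (hJ : J ≤ d)
    (h : y / 2 ^ (d - J) = prefixNum g J) : y / 2 ^ (d - j) = prefixNum g j := by
  induction J, hj using Nat.le_induction with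
  | base => exact h
  | succ J hjJ ih => exact ih (by omega) (div_two_pow_sub_eq_prefixNum (by omega) h)

theorem prefixShift_div {d k J y : ℕ} {g h : ℕ → Fin 2} (hk : k ≤ J) (hJ : J ≤ d)
    (e : ∀ i, k ≤ i → h i = g i) (hy : y / 2 ^ (d - J) = prefixNum g J) :
    prefixShift k (prefixNum g k) (prefixNum h k) d y / 2 ^ (d - J) = prefixNum h J := by
  have h1 := prefixNum_add_eq hk e
  have hq : 0 < 2 ^ (d - J) := by positivity
  have h2 := Nat.div_add_mod y (2 ^ (d - J))
  have h3 := Nat.mod_lt y hq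
  rw [prefixShift, show d - k = (J - k) + (d - J) by omega, pow_add, ← mul_assoc, ← mul_assoc]
  rw [hy] at h2
  generalize 2 ^ (d - J) = q at *
  generalize y % q = r at *
  have h4 : y + prefixNum h k * 2 ^ (J - k) * q =
      prefixNum h J * q + r + prefixNum g k * 2 ^ (J - k) * q := by
    rw [← h2]
    calc q * prefixNum g J + r + prefixNum h k * 2 ^ (J - k) * q
        = (prefixNum g J + prefixNum h k * 2 ^ (J - k)) * q + r := by ring
      _ = _ := by rw [← h1]; ring
  rw [h4, Nat.add_sub_cancel, Nat.mul_comm, Nat.mul_add_div hq, Nat.div_eq_of_lt h3, add_zero]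

/-- The prefix s forces y ≥ s · 2^(d - k), so no subtraction is truncated. -/
theorem prefixShift_prefixShift {d k s t y : ℕ} (h : y / 2 ^ (d - k) = s) :
    prefixShift k t s d (prefixShift k s t d y) = y := by
  have := Nat.div_mul_le_self y (2 ^ (d - k))
  rw [h] at this
  unfold prefixShift
  omega

theorem app_prefixShift_mem {d y : U.Star .nat} (hinf : U.IsInfinite d) {g h : ℕ → Fin 2} {k : ℕ}
    (e : ∀ i, k ≤ i → h i = g i) (hy : y ∈ U.digitMonad d g) :
    app (ρ := .nat) (σ := .nat) (τ := .nat) (prefixShift k (prefixNum g k) (prefixNum h k)) d y ∈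
      U.digitMonad d h := by
  intro j
  rw [NatRel, rel_app]
  refine (hy (max j k)).mono₂ (natRel_fst (hinf (max j k))) fun p h1 h2 => ?_
  exact div_eq_prefixNum_of_le (le_max_left j k) h2.le
    (prefixShift_div (le_max_right j k) h2.le e h1)

theorem exists_natRel_div_eq {d x : U.Star .nat} (hx : x ∈ U.mulCut (U.htwoPow d)) :
    ∃ n : ℕ, U.NatRel (fun d x => x / 2 ^ d = n) d x := by
  obtain ⟨n, hn⟩ := mem_mulCut.1 hx
  induction n with
  | zero => exact absurd (hn.mono fun p hp => absurd hp (Nat.not_lt_zero _)) (holds_const.not.2 id)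
  | succ n ih =>
    have h : U.NatRel (fun d x => x < 2 ^ d * n ∨ x / 2 ^ d = n) d x := by
      refine hn.mono fun p hp => ?_
      by_contra! h
      have h1 := (Nat.le_div_iff_mul_le (Nat.two_pow_pos p.1)).2 (Nat.mul_comm _ _ ▸ h.1)
      have h2 := Nat.div_lt_of_lt_mul hp
      omega
    rcases holds_or.1 h with h | h
    exacts [ih h, ⟨n, h⟩]

/-- Every countably determined subset of `cℕ` is equinumerous with a subset of `[0, c)`. -/
theorem exists_equiv_subset_lt_two_pow {d : U.Star .nat} (hinf : U.IsInfinite d)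
    {X : Set (U.Star .nat)} (hX : U.IsCD X) (hXd : X ⊆ U.mulCut (U.htwoPow d)) :
    ∃ X' : Set (U.Star .nat), U.IsCD X' ∧ (∀ y ∈ X', U.NatRel (fun d y => y < 2 ^ d) d y) ∧
      U.CDLe X X' ∧ U.CDLe X' X := by
  classical
  obtain ⟨φ, hφ⟩ := exists_paradoxical_equiv
  choose κ hκ using hφ
  -- the data of the shift that maps a monad onto the monad of `φ (g, n)`
  let F : ℕ × ℕ × ℕ → U.Star .nat → U.Star .nat := fun i =>
    app (ρ := .nat) (σ := .nat) (τ := .nat)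
      (fun d x => prefixShift i.1 i.2.1 i.2.2 d (x % 2 ^ d)) d
  let F' : ℕ × ℕ × ℕ × ℕ → U.Star .nat → U.Star .nat := fun i =>
    app (ρ := .nat) (σ := .nat) (τ := .nat)
      (fun d y => i.1 * 2 ^ d + prefixShift i.2.1 i.2.2.2 i.2.2.1 d y) d
  -- The sequences g are uncountably many, but a shift depends on three natural numbers only; hence
  -- countably many internal functions suffice.
  let ix : (ℕ → Fin 2) → ℕ → ℕ × ℕ × ℕ := fun g n =>
    (κ g n, prefixNum g (κ g n), prefixNum (φ (g, n)) (κ g n))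
  let ix' : (ℕ → Fin 2) → ℕ × ℕ × ℕ × ℕ := fun h => ((φ.symm h).2, ix (φ.symm h).1 (φ.symm h).2)
  let rem : U.Star .nat → U.Star .nat := app (ρ := .nat) (σ := .nat) (τ := .nat)
    (fun d x => x % 2 ^ d) d
  -- The standard quotient of x by c. The default 0 is for x outside cℕ and plays no role.
  let ν : U.Star .nat → ℕ := fun x =>
    if h : ∃ n : ℕ, U.NatRel (fun d x => x / 2 ^ d = n) d x then h.choose else 0
  have hν : ∀ x (n : ℕ), U.NatRel (fun d x => x / 2 ^ d = n) d x → ν x = n := by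
    intro x n hn
    have h : ∃ n : ℕ, U.NatRel (fun d x => x / 2 ^ d = n) d x := ⟨n, hn⟩
    simp only [ν, dif_pos h]
    exact holds_const.1 (h.choose_spec.mono₂ hn fun p h1 h2 => h1.symm.trans h2)
  let Θ : U.Star .nat → U.Star .nat := fun x => F (ix (U.leadingDigits d (rem x)) (ν x)) x
  let Ψ : U.Star .nat → U.Star .nat := fun y => F' (ix' (U.leadingDigits d y)) y
  have hrem : ∀ x, U.NatRel (fun d y => y < 2 ^ d) d (rem x) := by
    intro x
    rw [NatRel, rel_app]
    exact holds_of_forall fun p => Nat.mod_lt _ (Nat.two_pow_pos _)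
  have hF : ∀ i x, F i x = app (ρ := .nat) (σ := .nat) (τ := .nat)
      (prefixShift i.1 i.2.1 i.2.2) d (rem x) := fun i x => (app_app _ _ _ _).symm
  have hid : ∀ x, app (ρ := .nat) (σ := .nat) (τ := .nat) (fun _ y => y) d x = x :=
    fun x => map_snd d x
  have hΘ : ∀ x n, U.NatRel (fun d x => x / 2 ^ d = n) d x →
      U.NatRel (fun d y => y < 2 ^ d) d (Θ x) ∧ Ψ (Θ x) = x := by
    intro x n hn
    set g := U.leadingDigits d (rem x) with hg
    have h1 : rem x ∈ U.digitMonad d g := self_mem_digitMonad hinf (hrem x)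
    have h2 : Θ x = app (ρ := .nat) (σ := .nat) (τ := .nat)
        (prefixShift (κ g n) (prefixNum g (κ g n)) (prefixNum (φ (g, n)) (κ g n))) d (rem x) := by
      simp only [Θ, hν x n hn, hF]
      rfl
    have h3 : Θ x ∈ U.digitMonad d (φ (g, n)) := by
      rw [h2]
      exact app_prefixShift_mem hinf (hκ g n) h1
    obtain ⟨h4, h5⟩ := (mem_digitMonad_iff hinf).1 h3
    refine ⟨h4, ?_⟩
    have h6 : ix' (U.leadingDigits d (Θ x)) = (n, ix g n) := by
      simp only [ix', h5, Equiv.symm_apply_apply]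
    have h7 := h1 (κ g n)
    rw [NatRel, rel_app] at h7
    simp only [Ψ]
    rw [h6, h2]
    nth_rewrite 2 [← hid x]
    simp only [F', rem, app_app]
    rw [app_eq_app]
    refine h7.mono₂ hn fun p e1 e2 => ?_
    simp only [ix]
    rw [prefixShift_prefixShift e1, ← e2, mul_comm]
    exact Nat.div_add_mod _ _
  have hΨ : ∀ y, U.NatRel (fun d y => y < 2 ^ d) d y →
      Θ (Ψ y) = y ∧ ∃ n : ℕ, U.NatRel (fun d x => x / 2 ^ d = n) d (Ψ y) := by
    intro y hy
    set h := U.leadingDigits d y with hh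
    obtain ⟨g, n, hgn⟩ : ∃ g n, φ.symm h = (g, n) := ⟨_, _, rfl⟩
    have hφ : φ (g, n) = h := by rw [← hgn, Equiv.apply_symm_apply]
    have h1 : y ∈ U.digitMonad d h := self_mem_digitMonad hinf hy
    have hκ' : ∀ i, κ g n ≤ i → g i = h i := fun i hi => by rw [← hφ, hκ g n i hi]
    have h2 := app_prefixShift_mem hinf hκ' h1
    obtain ⟨h3, h4⟩ := (mem_digitMonad_iff hinf).1 h2
    set y' := app (ρ := .nat) (σ := .nat) (τ := .nat)
      (prefixShift (κ g n) (prefixNum h (κ g n)) (prefixNum g (κ g n))) d y with hy'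
    have h5 : Ψ y = app (ρ := .nat) (σ := .nat) (τ := .nat) (fun d x => n * 2 ^ d + x) d y' := by
      rw [hy', app_app]
      simp only [Ψ, ix', ix, F']
      rw [← hh, hgn, hφ]
    have h6 : rem (Ψ y) = y' := by
      rw [h5]
      nth_rewrite 2 [← hid y']
      simp only [rem, app_app]
      rw [app_eq_app]
      refine h3.mono fun p hp => ?_
      dsimp only
      rw [mul_comm, Nat.mul_add_mod]
      exact Nat.mod_eq_of_lt hp
    have h7 : U.NatRel (fun d x => x / 2 ^ d = n) d (Ψ y) := by
      rw [h5, NatRel, rel_app]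
      refine h3.mono fun p hp => ?_
      dsimp only
      rw [mul_comm, Nat.mul_add_div (Nat.two_pow_pos _), Nat.div_eq_of_lt hp, add_zero]
    refine ⟨?_, n, h7⟩
    have h8 : Θ (Ψ y) = F (ix g n) (Ψ y) := by
      simp only [Θ, h6, h4, hν _ n h7]
    rw [h8, hF, h6, hy', app_app]
    nth_rewrite 2 [← hid y]
    rw [app_eq_app]
    refine (h1 (κ g n)).mono fun p hp => ?_
    simp only [ix, hφ]
    exact prefixShift_prefixShift hp
  have hF_int : ∀ i, InternalFun (F i) := fun i => internalFun_app _ _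
  have hF'_int : ∀ i, InternalFun (F' i) := fun i => internalFun_app _ _
  have hΨCD : CDMap U Ψ {y | U.NatRel (fun d y => y < 2 ^ d) d y} :=
    cdMap_of_countable (D := fun i => {y | U.leadingDigits d y ∈ {h | ix' h = i}}) hF'_int
      (fun i => isCD_leadingDigits_mem d _) (fun y _ => ⟨_, rfl⟩)
      fun i y (hy : ix' _ = i) _ => by simp only [Ψ, hy]
  have hΘCD : CDMap U Θ X := by
    refine cdMap_of_countable (ι := ℕ × ℕ × ℕ × ℕ) (F := fun i => F i.2)
      (D := fun i => {x | U.NatRel (fun d x => x / 2 ^ d = i.1) d x} ∩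
        rem ⁻¹' {y | U.leadingDigits d y ∈ {g | ix g i.1 = i.2}})
      (fun i => hF_int _) (fun i => ?_) (fun x hx => ?_) ?_
    · exact (isInternal_rel (ρ := .nat) (σ := .nat) _ d).isCD.inter
        ((isCD_leadingDigits_mem d _).preimage (internalFun_app _ _))
    · obtain ⟨n, hn⟩ := exists_natRel_div_eq (hXd hx)
      exact ⟨(n, ix (U.leadingDigits d (rem x)) n), hn, rfl⟩
    · rintro i x ⟨hx1, hx2 : ix _ _ = _⟩ _
      simp only [Θ, hν x _ hx1, hx2]
  refine ⟨{y | U.NatRel (fun d y => y < 2 ^ d) d y} ∩ Ψ ⁻¹' X,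
    hΨCD.isCD_preimage (isCD_lt_two_pow d) hX, fun y hy => hy.1, hΘCD.cdLe hX ?_ ?_, ?_⟩
  · intro x hx
    obtain ⟨n, hn⟩ := exists_natRel_div_eq (hXd hx)
    refine ⟨(hΘ x n hn).1, ?_⟩
    rw [Set.mem_preimage, (hΘ x n hn).2]
    exact hx
  · intro x hx x' hx' e
    obtain ⟨n, hn⟩ := exists_natRel_div_eq (hXd hx)
    obtain ⟨n', hn'⟩ := exists_natRel_div_eq (hXd hx')
    rw [← (hΘ x n hn).2, e, (hΘ x' n' hn').2]
  · have hsub : CDMap U Ψ ({y | U.NatRel (fun d y => y < 2 ^ d) d y} ∩ Ψ ⁻¹' X) :=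
      hΨCD.comp (internalFun_id.cdMap _) fun y hy => hy.1
    refine hsub.cdLe (hΨCD.isCD_preimage (isCD_lt_two_pow d) hX) (fun y hy => hy.2) ?_
    intro y hy y' hy' e
    rw [← (hΨ y hy.1).1, e, (hΨ y' hy'.1).1]

/-! ### Hyperintegers below `2 ^ d` as internal binary sequences of length `d` -/

/-- The graph of the sequence of the `d` binary digits of `y < 2 ^ d`. -/
def bitGraph (d y : ℕ) : Set (ℕ × ℕ) := {q | q.1 < d ∧ q.2 = y / 2 ^ (d - (q.1 + 1)) % 2}

/-- Graphs of functions `[0, d) → {0, 1}`. -/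
def IsBinaryGraph (d : ℕ) (S : Set (ℕ × ℕ)) : Prop :=
  (∀ q, q ∈ S → q.1 < d ∧ q.2 < 2) ∧ ∀ k, k < d → ∃ i, (k, i) ∈ S ∧ ∀ j, (k, j) ∈ S → j = i

open Classical in
/-- The number with a given graph of binary digits. -/
noncomputable def bitNum (d : ℕ) (S : Set (ℕ × ℕ)) : ℕ :=
  if h : ∃ y, y < 2 ^ d ∧ bitGraph d y = S then h.choose else 0

theorem isBinaryGraph_bitGraph (d y : ℕ) : IsBinaryGraph d (bitGraph d y) :=
  ⟨fun _ hq => ⟨hq.1, hq.2 ▸ Nat.mod_lt _ two_pos⟩,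
    fun k hk => ⟨y / 2 ^ (d - (k + 1)) % 2, ⟨hk, rfl⟩, fun _ hj => hj.2⟩⟩

theorem bitGraph_injOn {d y y' : ℕ} (hy : y < 2 ^ d) (hy' : y' < 2 ^ d)
    (h : bitGraph d y = bitGraph d y') : y = y' := by
  have key : ∀ k ≤ d, y / 2 ^ (d - k) = y' / 2 ^ (d - k) := by
    intro k
    induction k with
    | zero => simp [Nat.div_eq_of_lt hy, Nat.div_eq_of_lt hy']
    | succ k ih =>
      intro hk
      have h1 := ih (by omega)
      rw [← div_two_pow_sub_div_two hk, ← div_two_pow_sub_div_two hk] at h1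
      have h2 : (k, y / 2 ^ (d - (k + 1)) % 2) ∈ bitGraph d y' := h ▸ ⟨hk, rfl⟩
      have h3 := h2.2
      dsimp only at h3
      omega
  simpa using key d le_rfl

theorem prefixNum_lt (g : ℕ → Fin 2) (k : ℕ) : prefixNum g k < 2 ^ k := by
  induction k with
  | zero => simp [prefixNum]
  | succ k ih =>
    rw [prefixNum, pow_succ]
    have := (g k).2
    omega

theorem prefixNum_add_div (g : ℕ → Fin 2) (k j : ℕ) :
    prefixNum g (k + j) / 2 ^ j = prefixNum g k := by
  induction j with
  | zero => simp
  | succ j ih =>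
    rw [← ih, pow_succ', ← Nat.div_div_eq_div_mul, ← add_assoc, prefixNum]
    congr 1
    have := (g (k + j)).2
    omega

theorem IsBinaryGraph.exists_bitGraph {d : ℕ} {S : Set (ℕ × ℕ)} (h : IsBinaryGraph d S) :
    ∃ y, y < 2 ^ d ∧ bitGraph d y = S := by
  have h1 : ∀ k, ∃ i : Fin 2, k < d → (k, (i : ℕ)) ∈ S ∧ ∀ j, (k, j) ∈ S → j = i := by
    intro k
    by_cases hk : k < d
    · obtain ⟨i, hi, hj⟩ := h.2 k hk
      exact ⟨⟨i, (h.1 _ hi).2⟩, fun _ => ⟨hi, hj⟩⟩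
    · exact ⟨0, fun h => absurd h hk⟩
  choose g hg using h1
  refine ⟨prefixNum g d, prefixNum_lt g d, ?_⟩
  have hbit : ∀ k < d, prefixNum g d / 2 ^ (d - (k + 1)) % 2 = g k := by
    intro k hk
    have h2 := prefixNum_add_div g (k + 1) (d - (k + 1))
    rw [Nat.add_sub_cancel' hk] at h2
    rw [h2, prefixNum, Nat.mul_add_mod]
    exact Nat.mod_eq_of_lt (g k).2
  ext ⟨k, i⟩
  constructor
  · rintro ⟨hk, hi⟩
    dsimp only at hk hi
    rw [hi, hbit k hk]
    exact (hg k hk).1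
  · intro hki
    have hk := (h.1 _ hki).1
    refine ⟨hk, ?_⟩
    dsimp only
    rw [hbit k hk]
    exact (hg k hk).2 i hki

theorem IsBinaryGraph.bitNum_spec {d : ℕ} {S : Set (ℕ × ℕ)} (h : IsBinaryGraph d S) :
    bitNum d S < 2 ^ d ∧ bitGraph d (bitNum d S) = S := by
  have := h.exists_bitGraph
  simp only [bitNum, dif_pos this]
  exact this.choose_spec

theorem bitNum_bitGraph {d y : ℕ} (hy : y < 2 ^ d) : bitNum d (bitGraph d y) = y := by
  have := (isBinaryGraph_bitGraph d y).bitNum_spec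
  exact bitGraph_injOn this.1 hy this.2

/-- `IsBinaryGraph` mirrors `internalSeqs` quantifier by quantifier, with `∃!` unfolded, so the two
match under transfer. -/
theorem mem_internalSeqs_iff {d : U.Star .nat} {S : U.Star (.pow (.prod .nat .nat))} :
    S ∈ U.internalSeqs d ↔ U.Rel (ρ := .nat) (σ := .pow (.prod .nat .nat)) IsBinaryGraph d S := by
  unfold Rel IsBinaryGraph internalSeqs
  rw [holds_and, holds_forall (τ := .prod .nat .nat), holds_forall (τ := .nat)]
  have h1 : ∀ k i, U.Holds (σ := .prod (.prod .nat (.pow (.prod .nat .nat))) (.prod .nat .nat))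
      (U.pair (U.pair d S) (U.pair k i)) (fun p => p.2 ∈ p.1.2 → p.2.1 < p.1.1 ∧ p.2.2 < 2) ↔
      (U.pair k i ∈ U.ext S → U.hlt k d ∧ U.hlt i (U.hnat 2)) := by
    intro k i
    obtain ⟨w, rfl, rfl, rfl, rfl⟩ := exists_joint₄ d S k i
    rw [mem_ext_iff, pair_map, pair_map, pair_map, holds_map, rel_map, hlt_map,
      hnat_eq_map 2 w, hlt_map, ← holds_and, ← holds_imp]
  refine and_congr ⟨fun h q => ?_, fun h k i => (h1 k i).1 (h _)⟩ (forall_congr' fun k => ?_)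
  · rw [← U.pair_eta q]
    exact (h1 _ _).2 (h _ _)
  · rw [holds_imp]
    refine imp_congr ?_ ?_
    · obtain ⟨w, rfl, rfl, rfl⟩ := exists_joint₃ d S k
      rw [hlt_map, pair_map, pair_map, holds_map]
    · rw [holds_exists (τ := .nat)]
      refine exists_congr fun i => ?_
      rw [holds_and, holds_forall (τ := .nat)]
      refine and_congr ?_ (forall_congr' fun j => ?_)
      · obtain ⟨w, rfl, rfl, rfl, rfl⟩ := exists_joint₄ d S k i
        dsimp only
        rw [mem_ext_iff, pair_map, rel_map, pair_map, pair_map, pair_map, holds_map]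
      · obtain ⟨v, rfl, rfl⟩ := exists_joint₂ i j
        obtain ⟨w, rfl, rfl, rfl, rfl⟩ := exists_joint₄ d S k v
        dsimp only
        rw [map_map (τ := .prod .nat .nat), map_map (τ := .prod .nat .nat), mem_ext_iff, pair_map,
          rel_map, ← holds_eq, ← holds_imp, pair_map, pair_map, pair_map, pair_map, holds_map]

/-- A standard n is below the infinite d, so the bound in `bitGraph` is automatic and only the digit
matters. -/
theorem pair_hnat_mem_ext_iff {d y : U.Star .nat} (hinf : U.IsInfinite d) {n : ℕ} {v : Fin 2} :
    U.pair (U.hnat n) (U.hnat v) ∈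
        U.ext (app (ρ := .nat) (σ := .nat) (τ := .pow (.prod .nat .nat)) bitGraph d y) ↔
      U.leadingDigits d y n = v := by
  have h1 : U.pair (U.hnat n) (U.hnat v) ∈
        U.ext (app (ρ := .nat) (σ := .nat) (τ := .pow (.prod .nat .nat)) bitGraph d y) ↔
      U.NatRel (fun d y => (v : ℕ) = y / 2 ^ (d - (n + 1)) % 2) d y := by
    have hd := hinf n
    obtain ⟨w, rfl, rfl⟩ := exists_natJoint₂ d y
    rw [holds_map] at hd
    rw [hnat_eq_map n w, hnat_eq_map v w, app_map, pair_map, mem_ext_map, NatRel, rel_map]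
    have e := rel_map (U := U) (ρ := .prod .nat .nat) (τ := .prod .nat .nat)
      (P := fun a b => b ∈ bitGraph a.1 a.2) (f := fun a => a) (g := fun _ => (n, (v : ℕ))) (w := w)
    rw [U.map_id] at e
    rw [e]
    exact ⟨fun h => h.mono fun a ha => ha.2, fun h => hd.mono₂ h fun a h1 h2 => ⟨h1, h2⟩⟩
  rw [h1]
  have hv : v = 0 ∨ v = 1 := by omega
  by_cases h : U.NatRel (fun d y => y / 2 ^ (d - (n + 1)) % 2 = 1) d y
  · simp only [leadingDigits, if_pos h]
    rcases hv with rfl | rfl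
    · refine iff_of_false (fun h' => ?_) (by decide)
      exact holds_const.1 (h.mono₂ h' fun p e1 e2 => absurd (e2.trans e1) (by decide))
    · exact iff_of_true (h.mono fun p hp => hp.symm) rfl
  · simp only [leadingDigits, if_neg h]
    rcases hv with rfl | rfl
    · refine iff_of_true ((holds_not.2 h).mono fun p hp => ?_) rfl
      exact ((Nat.mod_two_eq_zero_or_one _).resolve_right hp).symm
    · exact iff_of_false (fun h' => h (h'.mono fun p hp => hp.symm)) (by decide)

/-- Reading off binary digits is an internal bijection from [0, 2^d) onto the internal 0-1 sequences
of length d, and the restriction of the image to ℕ is the sequence of leading digits. -/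
theorem cdEquiv_digitMonadUnion {d : U.Star .nat} (hinf : U.IsInfinite d) (G : Set (ℕ → Fin 2)) :
    U.CDEquiv (U.digitMonadUnion d G) (U.monadUnion d G) := by
  let Τ : StdType := .pow (.prod .nat .nat)
  let F : U.Star .nat → U.Star Τ := app (ρ := .nat) (σ := .nat) (τ := Τ) bitGraph d
  let F' : U.Star Τ → U.Star .nat := app (ρ := .nat) (σ := Τ) (τ := .nat) bitNum d
  have hF : InternalFun F := internalFun_app _ _
  have hF' : InternalFun F' := internalFun_app _ _
  have hmem : ∀ y, U.NatRel (fun d y => y < 2 ^ d) d y →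
      (F y ∈ U.monadUnion d G ↔ y ∈ U.digitMonadUnion d G) := by
    intro y hy
    have h1 : F y ∈ U.internalSeqs d := by
      rw [mem_internalSeqs_iff, rel_app]
      exact holds_of_forall fun p => isBinaryGraph_bitGraph p.1 p.2
    constructor
    · rintro ⟨-, g, hg, h⟩
      have : U.leadingDigits d y = g := funext fun n => (pair_hnat_mem_ext_iff hinf).1 (h n)
      exact ⟨hy, this ▸ hg⟩
    · rintro ⟨-, h⟩
      exact ⟨h1, _, h, fun n => (pair_hnat_mem_ext_iff hinf).2 rfl⟩
  have hF'F : ∀ y, U.NatRel (fun d y => y < 2 ^ d) d y → F' (F y) = y := by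
    intro y hy
    have hid : app (ρ := .nat) (σ := .nat) (τ := .nat) (fun _ y => y) d y = y := map_snd d y
    simp only [F, F', app_app]
    conv_rhs => rw [← hid]
    rw [app_eq_app]
    exact hy.mono fun p hp => bitNum_bitGraph hp
  have hFF' : ∀ S ∈ U.internalSeqs d, U.NatRel (fun d y => y < 2 ^ d) d (F' S) ∧ F (F' S) = S := by
    intro S hS
    rw [mem_internalSeqs_iff] at hS
    have hid : app (ρ := .nat) (σ := Τ) (τ := Τ) (fun _ y => y) d S = S := map_snd d S
    constructor
    · rw [NatRel, rel_app]
      exact hS.mono fun p hp => hp.bitNum_spec.1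
    · simp only [F, F', app_app]
      conv_rhs => rw [← hid]
      rw [app_eq_app]
      exact hS.mono fun p hp => hp.bitNum_spec.2
  have hCD : U.IsCD (U.monadUnion d G) := by
    have h1 : U.IsCD (U.internalSeqs d) := by
      convert (isInternal_rel (U := U) (ρ := .nat) (σ := Τ) IsBinaryGraph d).isCD using 1
      exact Set.ext fun S => mem_internalSeqs_iff
    convert h1.inter ((isCD_digitMonadUnion d G).preimage hF') using 1
    ext S
    constructor
    · intro hS
      refine ⟨hS.1, ?_⟩
      rw [Set.mem_preimage, ← hmem _ (hFF' S hS.1).1, (hFF' S hS.1).2]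
      exact hS
    · rintro ⟨hS, h⟩
      rw [Set.mem_preimage, ← hmem _ (hFF' S hS).1, (hFF' S hS).2] at h
      exact h
  refine ⟨(hF.cdMap _).cdLe (isCD_digitMonadUnion d G) (fun y hy => (hmem y hy.1).2 hy) ?_,
    (hF'.cdMap _).cdLe hCD (fun S hS => ?_) ?_⟩
  · intro y hy y' hy' e
    rw [← hF'F y hy.1, e, hF'F y' hy'.1]
  · rw [← hmem _ (hFF' S hS.1).1, (hFF' S hS.1).2]
    exact hS
  · intro S hS S' hS' e
    rw [← (hFF' S hS.1).2, e, (hFF' S' hS'.1).2]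

/-! ### Small sets below `c/ℕ` and the final dichotomy -/

theorem cdLe_divCut_of_isSmall {d : U.Star .nat} {Z : U.Star (.pow .nat)} (hZ : U.IsSmall d Z)
    {X : Set (U.Star .nat)} (hX : U.IsCD X) (hXZ : X ⊆ U.ext Z) :
    U.CDLe X (U.divCut (U.htwoPow d)) := by
  -- The chain V is constantly Z. Every W k contains the first |Z| numbers, as |Z|(k + 1) ≤ 2^d. The
  -- shift to k + 1 keeps W 0 finite, because y * 0 < 2^d holds for every y.
  obtain ⟨F, hF, hi, hm⟩ := exists_internal_injOn_chain (ρ := .prod .nat (.pow .nat))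
    (z := U.pair d Z) (V := fun _ a => a.2) (W := fun k a => {y | y * (k + 1) < 2 ^ a.1})
    ((hZ 0).mono fun a ha => ⟨ha.1, (Set.finite_lt_nat (2 ^ a.1)).subset fun y hy =>
      lt_of_le_of_lt (Nat.le_mul_of_pos_right y (Nat.succ_pos 0)) hy⟩)
    (fun k => holds_of_forall fun a => subset_rfl)
    (fun k => holds_of_forall fun a y hy =>
      lt_of_le_of_lt (Nat.mul_le_mul_left y (Nat.le_succ (k + 1))) hy)
    (fun k => (hZ (k + 1)).mono fun a ha => by
      have h1 : (Finset.range (a.2.ncard) : Set ℕ) ⊆ {y | y * (k + 1) < 2 ^ a.1} := by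
        intro y hy
        have hy : y < a.2.ncard := by simpa using hy
        exact lt_of_lt_of_le (Nat.mul_lt_mul_of_pos_right hy (Nat.succ_pos k)) ha.2
      have h2 := Set.ncard_le_ncard h1 ((Set.finite_lt_nat (2 ^ a.1)).subset fun y hy =>
        lt_of_le_of_lt (Nat.le_mul_of_pos_right y (Nat.succ_pos k)) hy)
      rwa [Set.ncard_coe_finset, Finset.card_range] at h2)
  have hV : ∀ y ∈ X, U.Rel (ρ := .prod .nat (.pow .nat)) (σ := .nat) (fun a y => y ∈ a.2)
      (U.pair d Z) y := by
    intro y hy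
    have h := mem_ext_iff.1 (hXZ hy)
    exact (rel_snd_param (P := fun Z y => y ∈ Z) (z := d)).2 h
  refine (hF.cdMap X).cdLe hX (fun y hy => ?_) (hi.mono hV)
  rw [mem_divCut]
  intro n
  have h := hm n y (hV y hy)
  refine Holds.mono ((rel_fst_param (ρ := .nat) (τ := .pow .nat) (σ := .nat)
    (P := fun d y : ℕ => y * (n + 1) < 2 ^ d) (z' := Z)).1 h) fun p hp => ?_
  exact lt_of_le_of_lt (Nat.mul_le_mul_left _ (Nat.le_succ n)) hp

theorem cdLe_of_subset {X Y : Set (U.Star σ)} (hX : U.IsCD X) (h : X ⊆ Y) : U.CDLe X Y :=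
  (internalFun_id.cdMap X).cdLe hX h fun _ _ _ _ e => e

theorem cdLt_or_cdEquiv {d : U.Star .nat} (hinf : U.IsInfinite d) {X : Set (U.Star .nat)}
    (hX : U.IsCD X) (hXd : X ⊆ U.mulCut (U.htwoPow d)) :
    U.CDLt X (U.divCut (U.htwoPow d)) ∨ ∃ G, U.CDEquiv X (U.monadUnion d G) := by
  obtain ⟨X₁, hX₁, hlt, h1, h1'⟩ := exists_equiv_subset_lt_two_pow hinf hX hXd
  obtain ⟨H, B, X₂, hX₂, h2, h2'⟩ := exists_sorted hX₁ hlt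
  rcases cdLe_or_of_monotone_signature (ρ := .prod .nat (.pow (.prod .nat .nat))) hinf
    (δ := fun p => p.1) (map_fst d H)
    (fun p _ _ _ hij hj hl hm => sortFun_mono (p := p) hij hj hl hm) B hX₂ with
    ⟨Z, hZ, hXZ⟩ | ⟨G, h3, h3'⟩
  · obtain ⟨θ, -, hi, hg⟩ := id h2'
    have hX₂CD := (isCD_of_cdGraph hi hg).1
    -- A CD injection of c/ℕ into X would continue through the reductions into the small set Z.
    refine Or.inl ⟨(h1.trans h2).trans (cdLe_divCut_of_isSmall hZ hX₂CD hXZ), fun h => ?_⟩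
    exact not_cdLe_divCut_of_isSmall hinf hZ
      (((h.trans h1).trans h2).trans (cdLe_of_subset hX₂CD hXZ))
  · obtain ⟨h4, h4'⟩ := cdEquiv_digitMonadUnion hinf G
    exact Or.inr ⟨G, ((h1.trans h2).trans h3).trans h4, ((h4'.trans h3').trans h2').trans h1'⟩

end NonstandardUniverse

theorem mainTheorem7 (U : NonstandardUniverse.{u}) (c d : U.Star StdType.nat)
    (hcd : c = U.htwoPow d) (hc : ∀ n : ℕ, c ≠ U.hnat n)
    (X : Set (U.Star StdType.nat)) (hX : X ⊆ U.mulCut c) (hCD : U.IsCD X) :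
    U.CDLt X (U.divCut c) ∨ ∃ G : Set (ℕ → Fin 2), U.CDEquiv X (U.monadUnion d G) := by
  subst hcd
  exact NonstandardUniverse.cdLt_or_cdEquiv
    (NonstandardUniverse.isInfinite_of_htwoPow_ne hc) hCD hX
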